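/- Let $G$ be a locally compact second countable Hausdorff group with left Haar measure $\lambda$, and let $L^2(G)=L^2(G,\lambda)$. Let $\rho$ be the right regular representation of $G$ on $L^2(G)$, $(\rho(g)f)(x)=c(g)f(xg)$, where $c(g)>0$ is the constant that makes $\rho(g)$ unitary, and put $\pi(g)A=\rho(g)A\rho(g^{-1})$ for $g\in G$ and $A\in B(L^2(G))$, the algebra of bounded linear operators on $L^2(G)$. Let $\mathcal T(L^2(G))$ be the space of trace class operators; the weak* topology of $B(L^2(G))$ is the one given by the duality $\langle T,A\rangle=\operatorname{tr}(TA)$, $T\in\mathcal T(L^2(G))$. Let $\mu$ be a Borel probability measure on $G$, let $G_\mu$ be the smallest closed subgroup of $G$ containing the support of $\mu$, and let $$\mathcal H_{\mu\pi}=\Bigl\{A\in B(L^2(G)) : \operatorname{tr}(TA)=\int_G\operatorname{tr}\bigl(T\,\pi(g)A\bigr)\,\mu(dg)\ \text{ for every } T\in\mathcal T(L^2(G))\Bigr\},$$ $$B_0(L^2(G))=\bigl\{A\in B(L^2(G)) : g\mapsto\operatorname{tr}\bigl(T\,\pi(g)A\bigr)\ \text{vanishes at infinity for every } T\in\mathcal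 T(L^2(G))\bigr\}.$$ **Proposition 7.8.** Suppose that $G_\mu$ is not compact. Then every bounded linear operator $S\colon B(L^2(G))\to\mathcal H_{\mu\pi}$ which commutes with every weak* continuous linear operator on $B(L^2(G))$ commuting with $\pi$ (that is, with all $\pi(g)$, $g\in G$) vanishes on $B_0(L^2(G))$. In particular, every bounded projection $P$ of $B(L^2(G))$ onto $\mathcal H_{\mu\pi}$ which commutes with every weak* continuous linear operator on $B(L^2(G))$ commuting with $\pi$ vanishes on $B_0(L^2(G))$; such a $P$ is not weak* continuous, and it is in fact singular: for every normal (that is, weak* continuous) linear functional $\varphi$ on $B(L^2(G))$ the functional $\varphi\circ P$ is singular. Here a bounded linear functional $\theta$ on $B(L^2(G))$ is called singular if it belongs to the canonical complement of the space of normal functionals in the $\ell^1$-direct sum decomposition of $B(L^2(G))^*$ into normal and singular parts, i.e. if $\|\theta+\psi\|=\|\theta\|+\|\psi\|$ for every normal functional $\psi$. -/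

import Mathlib

open MeasureTheory Filter Topology
open scoped NNReal ENNReal

noncomputable section

namespace ChoquetDeny

section Hilbert

variable {H : Type*} [NormedAddCommGroup H] [InnerProductSpace ℂ H] [CompleteSpace H]

/-- Trace class (equivalently, nuclear) operators on a Hilbert space: the operators of the form
`T x = ∑ ⟪ξ n, x⟫ η n` with `∑ ‖ξ n‖ ^ 2 < ∞` and `∑ ‖η n‖ ^ 2 < ∞`. -/
def IsTraceClass (T : H →L[ℂ] H) : Prop :=
  ∃ ξ η : ℕ → H, Summable (fun n => ‖ξ n‖ ^ 2) ∧ Summable (fun n => ‖η n‖ ^ 2) ∧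
    ∀ x : H, HasSum (fun n => inner ℂ (ξ n) x • η n) (T x)

/-- The trace `∑ ⟪e i, T (e i)⟫` over an orthonormal basis `e` of the Hilbert space
(for trace class `T` it does not depend on the basis). -/
def trace (T : H →L[ℂ] H) : ℂ :=
  ∑' e : (exists_hilbertBasis ℂ H).choose, inner ℂ (e : H) (T (e : H))

/-- The weak* (ultraweak) topology of `B(H)`, regarded as the dual of the space of trace class
operators through the pairing `⟨T, A⟩ = tr (T A)`. -/
@[reducible] def weakStarTopology (H : Type*) [NormedAddCommGroup H] [InnerProductSpace ℂ H]
    [CompleteSpace H] : TopologicalSpace (H →L[ℂ] H) :=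
  ⨅ (T : H →L[ℂ] H) (_ : IsTraceClass T),
    TopologicalSpace.induced (fun A : H →L[ℂ] H => trace (T ∘L A)) inferInstance

/-- Continuity of an operator `B(H) → B(H)` from the weak* topology to the weak* topology. -/
def IsWeakStarContinuous (Φ : (H →L[ℂ] H) →L[ℂ] (H →L[ℂ] H)) : Prop :=
  @Continuous _ _ (weakStarTopology H) (weakStarTopology H) Φ

/-- Normal functionals on `B(H)`: those which come from the predual, `φ A = tr (T A)`
with `T` trace class. -/
def IsNormalFunctional (φ : (H →L[ℂ] H) →L[ℂ] ℂ) : Prop :=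
  ∃ T : H →L[ℂ] H, IsTraceClass T ∧ ∀ A : H →L[ℂ] H, φ A = trace (T ∘L A)

/-- Singular functionals on `B(H)`: the members of the complement of the predual in the canonical
decomposition `B(H)* = B(H)_* ⊕ (B(H)_*)^⊥` of the dual into its normal and its singular part.
This is an `ℓ¹`-direct sum, and its second summand consists of all those bounded
functionals `φ` with `‖φ + ψ‖ = ‖φ‖ + ‖ψ‖` for every normal `ψ`. -/
def IsSingularFunctional (φ : (H →L[ℂ] H) →L[ℂ] ℂ) : Prop :=
  ∀ ψ : (H →L[ℂ] H) →L[ℂ] ℂ, IsNormalFunctional ψ → ‖φ + ψ‖ = ‖φ‖ + ‖ψ‖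

/-- A bounded operator `Φ : B(H) → B(H)` is singular when its transpose maps every normal
functional to a singular functional. -/
def IsSingularOperator (Φ : (H →L[ℂ] H) →L[ℂ] (H →L[ℂ] H)) : Prop :=
  ∀ φ : (H →L[ℂ] H) →L[ℂ] ℂ, IsNormalFunctional φ → IsSingularFunctional (φ ∘L Φ)

end Hilbert

section Group

variable {G : Type*} [Group G] [TopologicalSpace G] [IsTopologicalGroup G]
  [LocallyCompactSpace G] [SecondCountableTopology G] [T2Space G]
  [MeasurableSpace G] [BorelSpace G]

/-- The smallest closed subgroup of `G` containing the support of `μ`. -/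
def supportSubgroup (μ : Measure G) : Subgroup G :=
  sInf {K : Subgroup G | IsClosed (K : Set G) ∧ μ.support ⊆ (K : Set G)}

/-- `L²(G)` with respect to the left Haar measure `lam`. -/
abbrev L2 (lam : Measure G) : Type _ := Lp ℂ 2 lam

/-- The normalizing factor `(d (lam · g) / d lam) ^ (1 / 2)` of the right regular representation.
Mathlib's `modularCharacterFun g` is the factor `D` with `lam (A g⁻¹) = D * lam A`. -/
def rightFactor (g : G) : ℝ≥0 := NNReal.sqrt (Measure.modularCharacterFun g)⁻¹

theorem eLpNorm_rightTranslate (lam : Measure G) [lam.IsHaarMeasure] (g : G) (f : L2 lam) :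
    eLpNorm (fun x => ((rightFactor g : ℝ) : ℂ) • f (x * g)) 2 lam = eLpNorm f 2 lam := by
  have hD : Measure.modularCharacterFun g ≠ 0 := (Measure.modularCharacterFun_pos g).ne'
  have hmeas : Measurable (fun x : G => x * g) := measurable_mul_const g
  have hmap := Measure.map_right_mul_eq_modularCharacterFun_smul lam g
  have hac : AEStronglyMeasurable f (Measure.map (fun x => x * g) lam) := by
    rw [hmap]
    exact (Lp.aestronglyMeasurable f).smul_measure _
  have h1 : eLpNorm (fun x => f (x * g)) 2 lam
      = (Measure.modularCharacterFun g : ℝ≥0∞) ^ (1 / 2 : ℝ) * eLpNorm f 2 lam := by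
    have h := eLpNorm_map_measure (p := 2) hac hmeas.aemeasurable
    have h2 : (f : G → ℂ) ∘ (fun x => x * g) = fun x => f (x * g) := rfl
    rw [h2] at h
    rw [← h, hmap]
    have h3 := eLpNorm_smul_measure_of_ne_zero
      (c := (Measure.modularCharacterFun g : ℝ≥0∞)) (by exact_mod_cast hD) (f : G → ℂ) 2 lam
    simpa using h3
  have h4 : (fun x => ((rightFactor g : ℝ) : ℂ) • f (x * g))
      = ((rightFactor g : ℝ) : ℂ) • (fun x => f (x * g)) := rfl
  rw [h4, eLpNorm_const_smul, h1, ← mul_assoc]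
  have h5 : ‖((rightFactor g : ℝ) : ℂ)‖ₑ
      = ((Measure.modularCharacterFun g)⁻¹ ^ (1 / 2 : ℝ) : ℝ≥0) := by
    rw [← ofReal_norm, Complex.norm_real, Real.norm_of_nonneg (NNReal.coe_nonneg _),
      ENNReal.ofReal_coe_nnreal, rightFactor, NNReal.sqrt_eq_rpow]
  rw [h5, ← ENNReal.coe_rpow_of_nonneg _ (by norm_num : (0 : ℝ) ≤ 1 / 2), ← ENNReal.coe_mul,
    ← NNReal.mul_rpow, inv_mul_cancel₀ hD]
  simp

theorem quasiMeasurePreserving_rightTranslate (lam : Measure G) [lam.IsHaarMeasure] (g : G) :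
    Measure.QuasiMeasurePreserving (fun x : G => x * g) lam lam :=
  ⟨measurable_mul_const g, by
    rw [Measure.map_right_mul_eq_modularCharacterFun_smul lam g]
    exact Measure.smul_absolutelyContinuous⟩

theorem memLp_rightTranslate (lam : Measure G) [lam.IsHaarMeasure] (g : G) (f : L2 lam) :
    MemLp (fun x => ((rightFactor g : ℝ) : ℂ) • f (x * g)) 2 lam := by
  refine ⟨?_, ?_⟩
  · exact ((Lp.aestronglyMeasurable f).comp_quasiMeasurePreserving
      (quasiMeasurePreserving_rightTranslate lam g)).const_smul ((rightFactor g : ℝ) : ℂ)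
  · rw [eLpNorm_rightTranslate]
    exact Lp.eLpNorm_lt_top f

/-- The right regular representation of `G` on `L²(G)`:
`(ρ(g) f)(x) = c(g) * f (x * g)`, where `c(g) > 0` makes `ρ(g)` isometric. -/
def rightRegular (lam : Measure G) [lam.IsHaarMeasure] (g : G) : L2 lam →ₗᵢ[ℂ] L2 lam where
  toFun f := (memLp_rightTranslate lam g f).toLp _
  map_add' f₁ f₂ := by
    rw [← MemLp.toLp_add, MemLp.toLp_eq_toLp_iff]
    have h := (quasiMeasurePreserving_rightTranslate lam g).ae (Lp.coeFn_add f₁ f₂)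
    filter_upwards [h] with x hx
    simp only [Pi.add_apply] at hx ⊢
    rw [hx, smul_add]
  map_smul' a f := by
    rw [RingHom.id_apply, ← MemLp.toLp_const_smul, MemLp.toLp_eq_toLp_iff]
    have h := (quasiMeasurePreserving_rightTranslate lam g).ae (Lp.coeFn_smul a f)
    filter_upwards [h] with x hx
    simp only [Pi.smul_apply] at hx ⊢
    rw [hx, smul_comm]
  norm_map' f := by
    change ‖(memLp_rightTranslate lam g f).toLp _‖ = ‖f‖
    rw [Lp.norm_toLp, eLpNorm_rightTranslate, Lp.norm_def]

/-- The right regular representation of `G` on `B(L²(G))`: `π(g) A = ρ(g) A ρ(g⁻¹)`. -/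
def conjAction (lam : Measure G) [lam.IsHaarMeasure] (g : G) (A : L2 lam →L[ℂ] L2 lam) :
    L2 lam →L[ℂ] L2 lam :=
  (rightRegular lam g).toContinuousLinearMap ∘L A ∘L
    (rightRegular lam g⁻¹).toContinuousLinearMap

/-- The space of `μ`-harmonic operators: those `A` with `π(μ) A = A`, where `π(μ) A` is
the weak* integral of `π(g) A` with respect to `μ(dg)`. -/
def harmonicOperators (lam : Measure G) [lam.IsHaarMeasure] (μ : Measure G) :
    Set (L2 lam →L[ℂ] L2 lam) :=
  {A | ∀ T : L2 lam →L[ℂ] L2 lam, IsTraceClass T →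
    trace (T ∘L A) = ∫ g, trace (T ∘L conjAction lam g A) ∂μ}

/-- `B₀(L²(G))`: the operators `A` such that for every trace class `T` the function
`g ↦ tr (T (π(g) A))` vanishes at infinity. -/
def vanishingOperators (lam : Measure G) [lam.IsHaarMeasure] : Set (L2 lam →L[ℂ] L2 lam) :=
  {A | ∀ T : L2 lam →L[ℂ] L2 lam, IsTraceClass T →
    Tendsto (fun g => trace (T ∘L conjAction lam g A)) (cocompact G) (𝓝 0)}

/-- `S` commutes with every weak* continuous operator on `B(L²(G))` which commutes with `π`. -/
def CommutesWithCommutant (lam : Measure G) [lam.IsHaarMeasure]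
    (S : (L2 lam →L[ℂ] L2 lam) →L[ℂ] (L2 lam →L[ℂ] L2 lam)) : Prop :=
  ∀ Φ : (L2 lam →L[ℂ] L2 lam) →L[ℂ] (L2 lam →L[ℂ] L2 lam), IsWeakStarContinuous Φ →
    (∀ (g : G) (A : L2 lam →L[ℂ] L2 lam), Φ (conjAction lam g A) = conjAction lam g (Φ A)) →
    ∀ A : L2 lam →L[ℂ] L2 lam, S (Φ A) = Φ (S A)

end Group

end ChoquetDeny

end

/-!
Write `π(x) A = ρ(x) A ρ(x⁻¹)`. For `p q : L²(G)` and an operator `A`, let `φ_A(x) = ⟪p, (π(x) A)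
q⟫` be the corresponding coefficient, a bounded continuous function, and let `M_φ` be the
multiplication operator of `φ`. The operator `A ↦ M_{φ_A}` on `B(L²(G))` (`coefficientMul`)
commutes with `π`, and it is weak* continuous (`isWeakStarContinuous_coefficientMul`): its predual
sends an operator of rank one to an integral of operators of rank one, which Parseval's identity
for vector-valued functions turns into a nuclear series. An operator `S` as in the theorem
therefore maps `M_{φ_A}` to `M_{φ_{S A}}`.

Left translates of `φ_A` are again coefficients of `A`. Hence a linear combination of left
translates of `φ_{S A}` is bounded at `1` by `‖S‖` times the supremum of the same combination of
left translates of `φ_A` (`CommutesWithCommutant.norm_sum_coefficient_le`). If `φ_A` vanishes at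
infinity and `φ_{S A}` does not, then `N` translates of `φ_A` which are almost disjointly supported
contradict this for large `N`. So `φ_{S A}` vanishes at infinity. As it is also `μ`-harmonic, the
maximum principle (`eq_zero_of_harmonic`) applies: the set where its modulus is maximal absorbs
right multiplication by the support of `μ`, and a compact nonempty set with this property forces
`G_μ` to be compact. Thus `φ_{S A} = 0` for all `p` and `q`, and `S A = 0`.

The matrix coefficients of `ρ` vanish at infinity, so that operators of rank one lie in `B₀(L²(G))`
(`rankOne_mem_vanishingOperators`). A projection `P` as in the theorem kills them but fixes the
identity operator, a weak* limit of finite-rank projections; so it is not weak* continuous.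
Moreover every functional `θ ∘ P` vanishes on the operators of finite rank, and such functionals
are singular (`isSingularFunctional_of_rankOne`).
-/

namespace ChoquetDeny

open InnerProductSpace BoundedContinuousFunction

/-! ### Traces, normal and singular functionals on `B(H)` -/

section Hilbert

variable {H : Type*} [NormedAddCommGroup H] [InnerProductSpace ℂ H]

theorem summable_mul_of_summable_sq {ι : Type*} {u v : ι → ℝ} (hu : Summable fun n => u n ^ 2)
    (hv : Summable fun n => v n ^ 2) : Summable fun n => |u n| * |v n| := by
  refine Summable.of_nonneg_of_le (fun n => by positivity) (fun n => ?_) (hu.add hv)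
  nlinarith [sq_nonneg (|u n| - |v n|), sq_abs (u n), sq_abs (v n), sq_nonneg (u n),
    sq_nonneg (v n)]

omit [InnerProductSpace ℂ H] in
theorem summable_norm_mul_norm {ι : Type*} {ξ η : ι → H} (hξ : Summable fun n => ‖ξ n‖ ^ 2)
    (hη : Summable fun n => ‖η n‖ ^ 2) : Summable fun n => ‖ξ n‖ * ‖η n‖ := by
  simpa using summable_mul_of_summable_sq hξ hη

theorem norm_inner_apply_le (A : H →L[ℂ] H) (x y : H) :
    ‖inner ℂ x (A y)‖ ≤ ‖A‖ * (‖x‖ * ‖y‖) := by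
  calc ‖inner ℂ x (A y)‖ ≤ ‖x‖ * ‖A y‖ := norm_inner_le_norm _ _
    _ ≤ ‖x‖ * (‖A‖ * ‖y‖) := by gcongr; exact A.le_opNorm y
    _ = _ := by ring

omit [InnerProductSpace ℂ H] in
theorem summable_norm_sq_single (p : H) :
    Summable fun n => ‖(Pi.single 0 p : ℕ → H) n‖ ^ 2 :=
  summable_of_ne_finset_zero (s := {0}) fun n hn => by simp_all

theorem hasSum_single_rankOne (p q x : H) :
    HasSum (fun n => inner ℂ ((Pi.single 0 p : ℕ → H) n) x • (Pi.single 0 q : ℕ → H) n)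
      (rankOne ℂ q p x) := by
  convert hasSum_single (0 : ℕ) ?_ using 1
  · simp
  · intro n hn
    simp [hn]

theorem isTraceClass_rankOne (p q : H) : IsTraceClass (rankOne ℂ q p) :=
  ⟨_, _, summable_norm_sq_single p, summable_norm_sq_single q, hasSum_single_rankOne p q⟩

variable {ι : Type*} (b : HilbertBasis ι ℂ H)

/-- The orthogonal projection onto the span of finitely many basis vectors. -/
noncomputable def finiteProjection (F : Finset ι) : H →L[ℂ] H :=
  ∑ i ∈ F, rankOne ℂ (b i) (b i)

theorem finiteProjection_apply (F : Finset ι) (x : H) :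
    finiteProjection b F x = ∑ i ∈ F, inner ℂ (b i) x • b i := by
  simp [finiteProjection]

theorem tendsto_finiteProjection (x : H) :
    Tendsto (fun F => finiteProjection b F x) atTop (𝓝 x) := by
  have := b.hasSum_repr x
  simp only [b.repr_apply_apply] at this
  simp only [finiteProjection_apply]
  exact this

theorem inner_finiteProjection_left (F : Finset ι) (x y : H) :
    inner ℂ (finiteProjection b F x) y = inner ℂ x (finiteProjection b F y) := by
  simp only [finiteProjection_apply, sum_inner, inner_sum, inner_smul_left, inner_smul_right,
    inner_conj_symm]
  exact Finset.sum_congr rfl fun i _ => mul_comm _ _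

theorem finiteProjection_idem (F : Finset ι) (x : H) :
    finiteProjection b F (finiteProjection b F x) = finiteProjection b F x := by
  classical
  conv_lhs => rw [finiteProjection_apply]
  conv_rhs => rw [finiteProjection_apply]
  refine Finset.sum_congr rfl fun i hi => ?_
  congr 1
  rw [finiteProjection_apply, inner_sum]
  simp only [inner_smul_right, orthonormal_iff_ite.1 b.orthonormal]
  simp [hi]

theorem norm_sq_finiteProjection_add (F : Finset ι) (x : H) :
    ‖x‖ ^ 2 = ‖finiteProjection b F x‖ ^ 2 + ‖x - finiteProjection b F x‖ ^ 2 := by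
  have h0 : inner ℂ (finiteProjection b F x) (x - finiteProjection b F x) = 0 := by
    rw [inner_sub_right, inner_finiteProjection_left, inner_finiteProjection_left,
      finiteProjection_idem, sub_self]
  have := norm_add_sq_eq_norm_sq_add_norm_sq_of_inner_eq_zero _ _ h0
  rw [add_sub_cancel] at this
  simpa [sq] using this

theorem norm_finiteProjection_le (F : Finset ι) (x : H) : ‖finiteProjection b F x‖ ≤ ‖x‖ := by
  have := norm_sq_finiteProjection_add b F x
  exact le_of_sq_le_sq (by nlinarith [sq_nonneg ‖x - finiteProjection b F x‖]) (norm_nonneg _)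

theorem norm_sub_finiteProjection_le (F : Finset ι) (x : H) :
    ‖x - finiteProjection b F x‖ ≤ ‖x‖ := by
  have := norm_sq_finiteProjection_add b F x
  exact le_of_sq_le_sq (by nlinarith [sq_nonneg ‖finiteProjection b F x‖]) (norm_nonneg _)

/-- The block diagonal operator `Q A Q + (1 - Q) B (1 - Q)` for the projection `Q` onto the span of
finitely many basis vectors. -/
noncomputable def blockDiag (F : Finset ι) (A B : H →L[ℂ] H) : H →L[ℂ] H :=
  finiteProjection b F ∘L A ∘L finiteProjection b F +
    (1 - finiteProjection b F) ∘L B ∘L (1 - finiteProjection b F)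

theorem norm_blockDiag_le (F : Finset ι) {A B : H →L[ℂ] H} (hA : ‖A‖ ≤ 1) (hB : ‖B‖ ≤ 1) :
    ‖blockDiag b F A B‖ ≤ 1 := by
  refine ContinuousLinearMap.opNorm_le_bound _ zero_le_one fun x => ?_
  rw [one_mul]
  set Q := finiteProjection b F with hQ
  have hval : blockDiag b F A B x = Q (A (Q x)) + (B (x - Q x) - Q (B (x - Q x))) := by
    simp [blockDiag, hQ]
    abel
  have h0 : inner ℂ (Q (A (Q x))) (B (x - Q x) - Q (B (x - Q x))) = 0 := by
    rw [inner_sub_right, inner_finiteProjection_left, inner_finiteProjection_left,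
      finiteProjection_idem, sub_self]
  have hpy := norm_add_sq_eq_norm_sq_add_norm_sq_of_inner_eq_zero _ _ h0
  have hx := norm_sq_finiteProjection_add b F x
  have h1 : ‖Q (A (Q x))‖ ≤ ‖Q x‖ := (norm_finiteProjection_le b F _).trans
    ((A.le_of_opNorm_le hA _).trans_eq (one_mul _))
  have h2 : ‖B (x - Q x) - Q (B (x - Q x))‖ ≤ ‖x - Q x‖ :=
    (norm_sub_finiteProjection_le b F _).trans ((B.le_of_opNorm_le hB _).trans_eq (one_mul _))
  rw [hval]
  refine le_of_sq_le_sq ?_ (norm_nonneg _)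
  rw [hx, sq, hpy]
  nlinarith [norm_nonneg (Q (A (Q x))), norm_nonneg (B (x - Q x) - Q (B (x - Q x)))]

theorem tendsto_inner_blockDiag (A B : H →L[ℂ] H) (x y : H) :
    Tendsto (fun F => inner ℂ x (blockDiag b F A B y)) atTop (𝓝 (inner ℂ x (A y))) := by
  have hx := tendsto_finiteProjection b x
  have hy := tendsto_finiteProjection b y
  have hval : ∀ F, inner ℂ x (blockDiag b F A B y) =
      inner ℂ (finiteProjection b F x) (A (finiteProjection b F y)) +
        inner ℂ (x - finiteProjection b F x) (B (y - finiteProjection b F y)) := by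
    intro F
    rw [inner_finiteProjection_left, inner_sub_left, inner_finiteProjection_left, ← inner_sub_right,
      ← inner_add_right]
    simp only [blockDiag, _root_.add_apply, ContinuousLinearMap.comp_apply, _root_.sub_apply,
      one_apply_eq_self]
  simp only [hval]
  have h1 := hx.inner (𝕜 := ℂ) ((A.continuous.tendsto y).comp hy)
  have h2 := (tendsto_const_nhds (x := x)).sub hx |>.inner (𝕜 := ℂ)
    ((B.continuous.tendsto _).comp ((tendsto_const_nhds (x := y)).sub hy))
  have h3 := h1.add h2
  rw [sub_self, inner_zero_left, add_zero] at h3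
  exact h3

theorem hasSum_norm_inner_sq {ι : Type*} (b : HilbertBasis ι ℂ H) (x : H) :
    HasSum (fun i => ‖inner ℂ (b i) x‖ ^ 2) (‖x‖ ^ 2) := by
  have h := Complex.hasSum_re (b.hasSum_inner_mul_inner x x)
  convert h using 1
  · ext i
    rw [← inner_conj_symm x (b i), ← Complex.normSq_eq_conj_mul_self, Complex.ofReal_re,
      Complex.normSq_eq_norm_sq]
  · rw [inner_self_eq_norm_sq_to_K]
    norm_cast

variable [CompleteSpace H]

/-- The trace does not depend on the basis: `tr (T A)` is computed from any nuclear representation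
of `T`, by interchanging two absolutely convergent sums. -/
theorem trace_comp_eq_tsum {T : H →L[ℂ] H} {ξ η : ℕ → H} (hξ : Summable fun n => ‖ξ n‖ ^ 2)
    (hη : Summable fun n => ‖η n‖ ^ 2)
    (hT : ∀ x, HasSum (fun n => inner ℂ (ξ n) x • η n) (T x)) (A : H →L[ℂ] H) :
    trace (T ∘L A) = ∑' n, inner ℂ (ξ n) (A (η n)) := by
  set w := (exists_hilbertBasis ℂ H).choose
  obtain ⟨b, hb⟩ : ∃ b : HilbertBasis w ℂ H, ⇑b = ((↑) : w → H) :=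
    (exists_hilbertBasis ℂ H).choose_spec
  have hterm : ∀ (n : ℕ) (e : w), inner ℂ (A.adjoint (ξ n)) (b e) * inner ℂ (b e) (η n) =
      inner ℂ (ξ n) (A e) * inner ℂ (e : H) (η n) := by
    intro n e
    rw [ContinuousLinearMap.adjoint_inner_left, hb]
  have hrow : ∀ n, Summable fun e : w =>
      ‖inner ℂ (ξ n) (A e) * inner ℂ (e : H) (η n)‖ := by
    intro n
    have := (b.summable_inner_mul_inner (A.adjoint (ξ n)) (η n)).norm
    simpa only [hterm] using this
  have hrow_le : ∀ n, ∑' e : w, ‖inner ℂ (ξ n) (A e) * inner ℂ (e : H) (η n)‖ ≤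
      ‖A‖ ^ 2 * ‖ξ n‖ ^ 2 + ‖η n‖ ^ 2 := by
    intro n
    have h1 := hasSum_norm_inner_sq b (A.adjoint (ξ n))
    have h2 := hasSum_norm_inner_sq b (η n)
    refine ((hrow n).tsum_le_tsum (fun e => ?_) (h1.add h2).summable).trans ?_
    · rw [← hterm, norm_mul, ← inner_conj_symm, RCLike.norm_conj]
      nlinarith [sq_nonneg (‖inner ℂ (b e) (A.adjoint (ξ n))‖ - ‖inner ℂ (b e) (η n)‖),
        sq_nonneg ‖inner ℂ (b e) (A.adjoint (ξ n))‖, sq_nonneg ‖inner ℂ (b e) (η n)‖]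
    · rw [(h1.add h2).tsum_eq]
      gcongr
      rw [← mul_pow]
      gcongr
      exact (A.adjoint.le_opNorm _).trans_eq (by rw [LinearIsometryEquiv.norm_map])
  have hsum : Summable (Function.uncurry fun (n : ℕ) (e : w) =>
      inner ℂ (ξ n) (A e) * inner ℂ (e : H) (η n)) := by
    refine Summable.of_norm ?_
    refine (summable_prod_of_nonneg fun _ => norm_nonneg _).2 ⟨hrow, ?_⟩
    refine Summable.of_nonneg_of_le (fun n => tsum_nonneg fun _ => norm_nonneg _) hrow_le ?_
    exact (hξ.mul_left _).add hη
  have hcol : ∀ e : w, inner ℂ (e : H) ((T ∘L A) e) =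
      ∑' n, inner ℂ (ξ n) (A e) * inner ℂ (e : H) (η n) := by
    intro e
    have := (hT (A e)).mapL (innerSL ℂ (e : H))
    simp only [innerSL_apply_apply, inner_smul_right] at this
    exact this.tsum_eq.symm
  have hrow_eq : ∀ n, ∑' e : w, inner ℂ (ξ n) (A e) * inner ℂ (e : H) (η n) =
      inner ℂ (ξ n) (A (η n)) := by
    intro n
    have := b.tsum_inner_mul_inner (A.adjoint (ξ n)) (η n)
    simp only [hterm] at this
    rw [this, ContinuousLinearMap.adjoint_inner_left]
  calc trace (T ∘L A) = ∑' e : w, ∑' n, inner ℂ (ξ n) (A e) * inner ℂ (e : H) (η n) :=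
        tsum_congr hcol
    _ = ∑' n, ∑' e : w, inner ℂ (ξ n) (A e) * inner ℂ (e : H) (η n) := hsum.tsum_comm
    _ = _ := tsum_congr hrow_eq

/-- Square summable families indexed by a countable type define a trace class operator
`∑ ⟪a i, ·⟫ b i`. -/
theorem exists_isTraceClass_trace_comp {ι : Type*} [Countable ι] {a b : ι → H}
    (ha : Summable fun i => ‖a i‖ ^ 2) (hb : Summable fun i => ‖b i‖ ^ 2) :
    ∃ T : H →L[ℂ] H, IsTraceClass T ∧
      ∀ A : H →L[ℂ] H, trace (T ∘L A) = ∑' i, inner ℂ (a i) (A (b i)) := by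
  obtain ⟨f, hf⟩ := exists_injective_nat ι
  set ξ : ℕ → H := Function.extend f a 0
  set η : ℕ → H := Function.extend f b 0
  have hext : ∀ c : ι → H, (fun n => ‖Function.extend f c 0 n‖ ^ 2) =
      Function.extend f (fun i => ‖c i‖ ^ 2) 0 := by
    intro c
    ext n
    by_cases hn : ∃ i, f i = n
    · obtain ⟨i, rfl⟩ := hn
      simp [hf.extend_apply]
    · simp [Function.extend_apply' _ _ _ hn]
  have hξ : Summable fun n => ‖ξ n‖ ^ 2 := by
    rw [hext]; exact (hasSum_extend_zero hf).2 ha.hasSum |>.summable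
  have hη : Summable fun n => ‖η n‖ ^ 2 := by
    rw [hext]; exact (hasSum_extend_zero hf).2 hb.hasSum |>.summable
  have hs : Summable fun n => rankOne ℂ (η n) (ξ n) := by
    refine Summable.of_norm ?_
    simpa [mul_comm] using summable_norm_mul_norm hξ hη
  have hT : ∀ x, HasSum (fun n => inner ℂ (ξ n) x • η n) ((∑' n, rankOne ℂ (η n) (ξ n)) x) := by
    intro x
    have := hs.hasSum.mapL (ContinuousLinearMap.apply ℂ H x)
    simpa using this
  refine ⟨∑' n, rankOne ℂ (η n) (ξ n), ⟨ξ, η, hξ, hη, hT⟩, fun A => ?_⟩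
  rw [trace_comp_eq_tsum hξ hη hT, ← tsum_extend_zero hf]
  congr 1
  ext n
  by_cases hn : ∃ i, f i = n
  · obtain ⟨i, rfl⟩ := hn
    simp [hf.extend_apply, ξ, η]
  · simp [Function.extend_apply' _ _ _ hn, ξ]

theorem trace_rankOne_comp (p q : H) (A : H →L[ℂ] H) :
    trace (rankOne ℂ q p ∘L A) = inner ℂ p (A q) := by
  rw [trace_comp_eq_tsum (summable_norm_sq_single p) (summable_norm_sq_single q)
    (hasSum_single_rankOne p q), tsum_eq_single 0]
  · simp
  · intro n hn
    simp [hn]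

/-- An operator on `B(H)` which is the transpose of a map on trace class operators is weak*
continuous. -/
theorem isWeakStarContinuous_of_forall_exists (Φ : (H →L[ℂ] H) →L[ℂ] (H →L[ℂ] H))
    (h : ∀ T : H →L[ℂ] H, IsTraceClass T → ∃ T' : H →L[ℂ] H, IsTraceClass T' ∧
      ∀ A : H →L[ℂ] H, trace (T ∘L Φ A) = trace (T' ∘L A)) : IsWeakStarContinuous Φ := by
  refine continuous_iInf_rng.2 fun T => continuous_iInf_rng.2 fun hT => ?_
  obtain ⟨T', hT', he⟩ := h T hT
  refine continuous_induced_rng.2 ?_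
  have : (fun A : H →L[ℂ] H => trace (T ∘L A)) ∘ Φ = fun A => trace (T' ∘L A) := funext he
  rw [this]
  exact continuous_iInf_dom (i := T') (continuous_iInf_dom (i := hT') continuous_induced_dom)

/-- On bounded sets the functionals `tr (T ·)` are continuous for the weak operator topology, by
dominated convergence for series. -/
theorem tendsto_trace_of_tendsto_inner {α : Type*} {l : Filter α} {T : H →L[ℂ] H}
    (hT : IsTraceClass T) {A : α → H →L[ℂ] H} {B : H →L[ℂ] H} {C : ℝ} (hC : ∀ a, ‖A a‖ ≤ C)
    (h : ∀ x y, Tendsto (fun a => inner ℂ x (A a y)) l (𝓝 (inner ℂ x (B y)))) :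
    Tendsto (fun a => trace (T ∘L A a)) l (𝓝 (trace (T ∘L B))) := by
  obtain ⟨ξ, η, hξ, hη, hs⟩ := hT
  simp only [trace_comp_eq_tsum hξ hη hs]
  refine tendsto_tsum_of_dominated_convergence
    ((summable_norm_mul_norm hξ hη).mul_left C) (fun n => h _ _)
    (Eventually.of_forall fun a n => ?_)
  refine (norm_inner_apply_le _ _ _).trans ?_
  gcongr
  exact hC a

/-- A functional that vanishes on the operators of rank one only sees `B` in the block diagonal
operator, as the difference has finite rank. -/
theorem apply_blockDiag_of_rankOne {θ : (H →L[ℂ] H) →L[ℂ] ℂ}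
    (hθ : ∀ x y : H, θ (rankOne ℂ x y) = 0) (F : Finset ι) (A B : H →L[ℂ] H) :
    θ (blockDiag b F A B) = θ B := by
  have hl : ∀ X : H →L[ℂ] H, θ (X ∘L finiteProjection b F) = 0 := by
    intro X
    have : X ∘L finiteProjection b F = ∑ i ∈ F, rankOne ℂ (X (b i)) (b i) := by
      ext x
      simp [finiteProjection_apply]
    rw [this, map_sum]
    exact Finset.sum_eq_zero fun i _ => hθ _ _
  have hr : ∀ X : H →L[ℂ] H, θ (finiteProjection b F ∘L X) = 0 := by
    intro X
    have : finiteProjection b F ∘L X = ∑ i ∈ F, rankOne ℂ (b i) (X.adjoint (b i)) := by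
      ext x
      simp [finiteProjection_apply, ContinuousLinearMap.adjoint_inner_left]
    rw [this, map_sum]
    exact Finset.sum_eq_zero fun i _ => hθ _ _
  have hd : blockDiag b F A B = finiteProjection b F ∘L (A ∘L finiteProjection b F) + B
      - finiteProjection b F ∘L B - B ∘L finiteProjection b F
      + finiteProjection b F ∘L (B ∘L finiteProjection b F) := by
    ext x
    simp [blockDiag]
    abel
  rw [hd, map_add, map_sub, map_sub, map_add, hl, hr, hr, hr]
  simp

theorem exists_re_gt_of_lt_norm {V : Type*} [NormedAddCommGroup V] [NormedSpace ℂ V]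
    (f : V →L[ℂ] ℂ) {r : ℝ} (hr : r < ‖f‖) : ∃ x : V, ‖x‖ ≤ 1 ∧ r < (f x).re := by
  obtain ⟨x, hx1, hx⟩ := f.exists_lt_apply_of_lt_opNorm hr
  by_cases h0 : f x = 0
  · exact ⟨x, hx1.le, by rw [h0] at hx ⊢; simpa using hx⟩
  · refine ⟨((starRingEnd ℂ) (f x) / ‖f x‖) • x, ?_, ?_⟩
    · rw [norm_smul, norm_div, RCLike.norm_conj, Complex.norm_real, norm_norm,
        div_self (norm_ne_zero_iff.2 h0), one_mul]
      exact hx1.le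
    · rw [map_smul, smul_eq_mul, div_mul_eq_mul_div, ← Complex.normSq_eq_conj_mul_self,
        Complex.normSq_eq_norm_sq]
      have : ((‖f x‖ ^ 2 : ℝ) : ℂ) / (‖f x‖ : ℂ) = ((‖f x‖ : ℝ) : ℂ) := by
        rw [← Complex.ofReal_div, sq, mul_div_cancel_right₀ _ (norm_ne_zero_iff.2 h0)]
      rw [this, Complex.ofReal_re]
      exact hx

/-- A bounded functional on `B(H)` which vanishes on the operators of rank one is singular: a nearly
norming operator for a normal functional, cut down to a large finite-dimensional corner, and one for
the given functional, cut down to the complementary corner, do not interact, and their sum still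
has norm at most one. -/
theorem isSingularFunctional_of_rankOne {θ : (H →L[ℂ] H) →L[ℂ] ℂ}
    (hθ : ∀ x y : H, θ (rankOne ℂ x y) = 0) : IsSingularFunctional θ := by
  rintro ψ ⟨T, hT, hψ⟩
  refine le_antisymm (norm_add_le _ _) (le_of_forall_pos_lt_add fun ε hε => ?_)
  obtain ⟨A, hA1, hA⟩ := exists_re_gt_of_lt_norm ψ (r := ‖ψ‖ - ε / 4) (by linarith)
  obtain ⟨B, hB1, hB⟩ := exists_re_gt_of_lt_norm θ (r := ‖θ‖ - ε / 4) (by linarith)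
  obtain ⟨w, b, -⟩ := exists_hilbertBasis ℂ H
  have ht : Tendsto (fun F => (ψ (blockDiag b F A B)).re) atTop (𝓝 (ψ A).re) := by
    simp only [hψ]
    exact (Complex.continuous_re.tendsto _).comp (tendsto_trace_of_tendsto_inner hT
      (fun F => norm_blockDiag_le b F hA1 hB1) (tendsto_inner_blockDiag b A B))
  obtain ⟨F, hF⟩ := (ht.eventually_const_lt hA).exists
  have h1 : ((θ + ψ) (blockDiag b F A B)).re ≤ ‖θ + ψ‖ := by
    refine (Complex.re_le_norm _).trans (((θ + ψ).le_opNorm _).trans ?_)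
    exact mul_le_of_le_one_right (norm_nonneg _) (norm_blockDiag_le b F hA1 hB1)
  rw [_root_.add_apply, Complex.add_re, apply_blockDiag_of_rankOne b hθ] at h1
  linarith

/-- A weak* continuous operator vanishing on the operators of rank one vanishes at the identity, as
the latter is a weak* limit of finite-rank projections. -/
theorem apply_one_eq_zero_of_rankOne {Φ : (H →L[ℂ] H) →L[ℂ] (H →L[ℂ] H)}
    (hc : IsWeakStarContinuous Φ) (hΦ : ∀ x y : H, Φ (rankOne ℂ x y) = 0) (p q : H) :
    inner ℂ p (Φ 1 q) = 0 := by
  obtain ⟨w, b, -⟩ := exists_hilbertBasis ℂ H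
  have h1 : Tendsto (fun F => finiteProjection b F) atTop
      (@nhds _ (weakStarTopology H) (1 : H →L[ℂ] H)) := by
    simp only [nhds_iInf, nhds_induced, tendsto_iInf, tendsto_comap_iff]
    intro T hT
    refine tendsto_trace_of_tendsto_inner hT (C := 1) (fun F => ?_) fun x y => ?_
    · exact ContinuousLinearMap.opNorm_le_bound _ zero_le_one fun x => by
        simpa using norm_finiteProjection_le b F x
    · exact tendsto_const_nhds.inner (tendsto_finiteProjection b y)
  have h2 : @Continuous _ _ (weakStarTopology H) inferInstance
      (fun A : H →L[ℂ] H => trace (rankOne ℂ q p ∘L A)) :=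
    continuous_iInf_dom (i := rankOne ℂ q p)
      (continuous_iInf_dom (i := isTraceClass_rankOne p q) continuous_induced_dom)
  have h3 := (@Continuous.tendsto _ _ (weakStarTopology H) _ _
    (@Continuous.comp _ _ _ (weakStarTopology H) (weakStarTopology H) _ _ _ h2 hc) 1).comp h1
  have h4 : ∀ F, Φ (finiteProjection b F) = 0 := by
    intro F
    simp [finiteProjection, map_sum, hΦ]
  have h5 : Tendsto (fun _ : Finset w => (0 : ℂ)) atTop (𝓝 (inner ℂ p (Φ 1 q))) := by
    rw [← trace_rankOne_comp]
    refine h3.congr fun F => ?_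
    simp only [Function.comp_apply, h4]
    simp [trace]
  exact (tendsto_nhds_unique h5 tendsto_const_nhds)

end Hilbert

/-! ### Harmonic functions vanishing at infinity -/

section HarmonicFunctions

variable {G : Type*} [Group G] [TopologicalSpace G] [IsTopologicalGroup G]

/-- The powers of an element which stay in a compact set accumulate at the inverse. -/
theorem inv_mem_closure_pow {K : Set G} (hK : IsCompact K) {s : G}
    (hs : ∀ n : ℕ, s ^ n ∈ K) : s⁻¹ ∈ closure (Set.range fun n : ℕ => s ^ n) := by
  obtain ⟨x, -, hx⟩ := hK.exists_mapClusterPt (f := atTop) (u := fun n : ℕ => s ^ n)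
    (by rw [le_principal_iff, mem_map]; exact Eventually.of_forall hs)
  rw [mem_closure_iff_nhds]
  intro U hU
  have hc : Tendsto (fun z : G × G => z.1⁻¹ * z.2 * s⁻¹) (𝓝 (x, x)) (𝓝 s⁻¹) := by
    have : Continuous fun z : G × G => z.1⁻¹ * z.2 * s⁻¹ := by fun_prop
    simpa using this.tendsto (x, x)
  have hU' := hc hU
  rw [nhds_prod_eq, mem_map, mem_prod_self_iff] at hU'
  obtain ⟨V, hV, hVU⟩ := hU'
  have hfr := mapClusterPt_iff_frequently.1 hx V hV
  -- two powers close to the same cluster point have a quotient close to the identity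
  obtain ⟨m, hm⟩ := hfr.exists
  obtain ⟨n, hn, hmn⟩ := (hfr.and_eventually (eventually_ge_atTop (m + 1))).exists
  refine ⟨s ^ (n - m - 1), ?_, ⟨_, rfl⟩⟩
  have := @hVU (s ^ m, s ^ n) ⟨hm, hn⟩
  have he : (s ^ m)⁻¹ * s ^ n * s⁻¹ = s ^ (n - m - 1) := by
    rw [mul_inv_eq_iff_eq_mul, ← pow_succ, inv_mul_eq_iff_eq_mul, ← pow_add]
    congr 1
    omega
  simpa [he] using this

/-- The right stabilizer of a set. -/
def rightStabilizer (E : Set G) : Subgroup G where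
  carrier := {g | ∀ x ∈ E, x * g ∈ E ∧ x * g⁻¹ ∈ E}
  mul_mem' := by
    intro a b ha hb x hx
    refine ⟨?_, ?_⟩
    · rw [← mul_assoc]; exact (hb _ (ha x hx).1).1
    · rw [mul_inv_rev, ← mul_assoc]; exact (ha _ (hb x hx).2).2
  one_mem' := by intro x hx; simpa using hx
  inv_mem' := by
    intro a ha x hx
    simpa [and_comm] using ha x hx

theorem isClosed_rightStabilizer {E : Set G} (hE : IsClosed E) :
    IsClosed (rightStabilizer E : Set G) := by
  have : (rightStabilizer E : Set G) = ⋂ x ∈ E, {g | x * g ∈ E ∧ x * g⁻¹ ∈ E} := by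
    ext g; simp [rightStabilizer]
  rw [this]
  refine isClosed_biInter fun x _ => ?_
  exact (hE.preimage (by fun_prop : Continuous fun g : G => x * g)).inter
    (hE.preimage (by fun_prop : Continuous fun g : G => x * g⁻¹))

/-- A compact set which absorbs right multiplication by `s` is stable under it. -/
theorem mem_rightStabilizer_of_isCompact [T2Space G] {E : Set G} (hE : IsCompact E) {s : G}
    (hs : ∀ x ∈ E, x * s ∈ E) : s ∈ rightStabilizer E := by
  intro x hx
  refine ⟨hs x hx, ?_⟩
  have hpow : ∀ n : ℕ, x * s ^ n ∈ E := by
    intro n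
    induction n with
    | zero => simpa using hx
    | succ n ih => rw [pow_succ, ← mul_assoc]; exact hs _ ih
  have hK : IsCompact ((fun y => x⁻¹ * y) '' E) := hE.image (by fun_prop)
  -- as `s⁻¹` is a limit of powers of `s`, the point `x s⁻¹` is a limit of points `x sⁿ` of `E`
  have hcl := inv_mem_closure_pow hK (s := s) fun n => ⟨x * s ^ n, hpow n, by simp⟩
  have hsub : Set.range (fun n : ℕ => s ^ n) ⊆ (fun y => x * y) ⁻¹' E := by
    rintro _ ⟨n, rfl⟩; exact hpow n
  exact closure_minimal hsub (hE.isClosed.preimage (by fun_prop)) hcl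

variable [T2Space G] [MeasurableSpace G] [BorelSpace G]

omit [IsTopologicalGroup G] [T2Space G] [BorelSpace G] in
theorem isClosed_supportSubgroup (μ : Measure G) : IsClosed (supportSubgroup μ : Set G) := by
  rw [supportSubgroup, Subgroup.coe_sInf]
  exact isClosed_biInter fun K hK => hK.1

omit [BorelSpace G] in
/-- If a nonempty compact set absorbs right multiplication by the support of `μ`, then the closed
subgroup generated by the support is compact. -/
theorem isCompact_supportSubgroup {μ : Measure G} {E : Set G} (hE : IsCompact E)
    (hne : E.Nonempty) (h : ∀ x ∈ E, ∀ s ∈ μ.support, x * s ∈ E) :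
    IsCompact (supportSubgroup μ : Set G) := by
  have hle : supportSubgroup μ ≤ rightStabilizer E :=
    sInf_le ⟨isClosed_rightStabilizer hE.isClosed, fun s hs =>
      mem_rightStabilizer_of_isCompact hE fun x hx => h x hx s hs⟩
  obtain ⟨x, hx⟩ := hne
  have hK : IsCompact ((fun y => x⁻¹ * y) '' E) := hE.image (by fun_prop)
  refine hK.of_isClosed_subset (isClosed_supportSubgroup μ) fun g hg => ?_
  exact ⟨x * g, (hle hg x hx).1, by simp⟩

/-- Maximum principle: a continuous `μ`-harmonic function vanishing at infinity is zero unless `μ`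
lives on a compact subgroup. -/
theorem eq_zero_of_harmonic {μ : Measure G} [IsProbabilityMeasure μ]
    (hμ : ¬ IsCompact (supportSubgroup μ : Set G)) {ψ : G → ℂ} (hc : Continuous ψ)
    (h0 : Tendsto ψ (cocompact G) (𝓝 0)) (hh : ∀ h, ψ h = ∫ g, ψ (h * g) ∂μ) (g : G) :
    ψ g = 0 := by
  by_contra hg
  have hpos : 0 < ‖ψ g‖ := norm_pos_iff.2 hg
  have hev : ∀ᶠ x in cocompact G, ‖ψ x‖ < ‖ψ g‖ := by
    have := h0.norm
    rw [norm_zero] at this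
    exact this.eventually_lt_const hpos
  obtain ⟨m, hm⟩ := hc.norm.exists_forall_ge' g (hev.mono fun x hx => hx.le)
  have hmpos : 0 < ‖ψ m‖ := hpos.trans_le (hm g)
  set E : Set G := {x | ‖ψ m‖ ≤ ‖ψ x‖}
  have hEcl : IsClosed E := isClosed_le continuous_const hc.norm
  have hEc : IsCompact E := by
    have hev : ∀ᶠ x in cocompact G, ‖ψ x‖ < ‖ψ m‖ := by
      have := h0.norm
      rw [norm_zero] at this
      exact this.eventually_lt_const hmpos
    obtain ⟨K, hK, hKE⟩ := mem_cocompact.1 hev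
    refine hK.of_isClosed_subset hEcl fun x hx => ?_
    by_contra hxK
    exact absurd (show ‖ψ x‖ < ‖ψ m‖ from hKE hxK) (not_lt.2 hx)
  refine hμ (isCompact_supportSubgroup hEc ⟨m, le_refl ‖ψ m‖⟩ fun x hx s hs => ?_)
  -- the defect `‖ψ m‖ - ‖ψ (x g)‖` is nonnegative with nonpositive integral
  have hint : Integrable (fun g => ‖ψ (x * g)‖) μ := by
    refine Integrable.of_bound (C := ‖ψ m‖)
      (by fun_prop : Continuous fun g => ‖ψ (x * g)‖).aestronglyMeasurable
      (Eventually.of_forall fun g => ?_)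
    simpa using hm _
  have hnn : 0 ≤ᵐ[μ] fun g => ‖ψ m‖ - ‖ψ (x * g)‖ :=
    Eventually.of_forall fun g => sub_nonneg.2 (hm _)
  have hle : ‖ψ m‖ ≤ ∫ g, ‖ψ (x * g)‖ ∂μ :=
    (show ‖ψ m‖ ≤ ‖ψ x‖ from hx).trans (by rw [hh x]; exact norm_integral_le_integral_norm _)
  have hz : ∫ g, (‖ψ m‖ - ‖ψ (x * g)‖) ∂μ = 0 := by
    refine le_antisymm ?_ (integral_nonneg_of_ae hnn)
    rw [integral_sub (integrable_const _) hint]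
    simpa using hle
  have hae := (integral_eq_zero_iff_of_nonneg_ae hnn ((integrable_const _).sub hint)).1 hz
  have hmem : {g | x * g ∈ E} ∈ ae μ := by
    filter_upwards [hae] with g hg
    have : ‖ψ m‖ - ‖ψ (x * g)‖ = 0 := hg
    change ‖ψ m‖ ≤ ‖ψ (x * g)‖
    linarith
  exact Measure.support_subset_of_isClosed
    (hEcl.preimage (by fun_prop : Continuous fun g => x * g)) hmem hs

end HarmonicFunctions

/-! ### Almost disjoint translates -/

section Translates

variable {G : Type*} [Group G] [TopologicalSpace G] [IsTopologicalGroup G]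

/-- If `ψ` does not vanish at infinity but `φ` does, then one finds arbitrarily many translates at
which `ψ` is large, while the corresponding left translates of `φ` are almost disjointly
supported. -/
theorem exists_finset_sum_translates_le {φ ψ : G → ℂ} {C δ ε : ℝ} (hC : ∀ x, ‖φ x‖ ≤ C)
    (hδ : 0 < δ) (hφ : Tendsto φ (cocompact G) (𝓝 0))
    (hψ : ∃ᶠ g in cocompact G, ε ≤ ‖ψ g‖) (N : ℕ) :
    ∃ s : Finset G, s.card = N ∧ (∀ g ∈ s, ε ≤ ‖ψ g‖) ∧
      ∀ x, ∑ g ∈ s, ‖φ (g * x)‖ ≤ C + N * δ := by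
  classical
  have hC0 : 0 ≤ C := (norm_nonneg _).trans (hC 1)
  have hev : ∀ᶠ x in cocompact G, ‖φ x‖ < δ := by
    have := hφ.norm
    rw [norm_zero] at this
    exact this.eventually_lt_const hδ
  obtain ⟨K, hK, hKφ⟩ := mem_cocompact.1 hev
  induction N with
  | zero => exact ⟨∅, by simp, by simp, by simpa using hC0⟩
  | succ N ih =>
    obtain ⟨s, hcard, hs, hsum⟩ := ih
    have hL : IsCompact (⋃ h ∈ s, (fun z : G × G => z.1 * z.2⁻¹ * h) '' (K ×ˢ K)) :=
      s.isCompact_biUnion fun h _ => (hK.prod hK).image (by fun_prop)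
    obtain ⟨g, hgψ, hg'⟩ := (hψ.and_eventually
      (hL.union s.finite_toSet.isCompact).compl_mem_cocompact).exists
    obtain ⟨hg, hgs⟩ : g ∉ _ ∧ g ∉ s := by simpa only [Set.mem_compl_iff, Set.mem_union, not_or,
      Finset.mem_coe] using hg'
    have hdisj : ∀ h ∈ s, ∀ x, g * x ∈ K → h * x ∉ K := by
      intro h hh x hgx hhx
      refine hg (Set.mem_biUnion hh ⟨(g * x, h * x), ⟨hgx, hhx⟩, ?_⟩)
      simp
    have hsmall : ∀ y, y ∉ K → ‖φ y‖ ≤ δ := fun y hy => (hKφ hy : ‖φ y‖ < δ).le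
    refine ⟨insert g s, by rw [Finset.card_insert_of_notMem hgs, hcard], ?_, fun x => ?_⟩
    · intro h hh
      rcases Finset.mem_insert.1 hh with rfl | hh
      · exact hgψ
      · exact hs h hh
    · rw [Finset.sum_insert hgs]
      push_cast
      by_cases hx : g * x ∈ K
      · have : ∑ h ∈ s, ‖φ (h * x)‖ ≤ N * δ := by
          rw [← hcard, ← nsmul_eq_mul]
          exact Finset.sum_le_card_nsmul _ _ _ fun h hh => hsmall _ (hdisj h hh x hx)
        linarith [hC (g * x)]
      · linarith [hsum x, hsmall _ hx]

end Translates

/-! ### The right regular representation -/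

theorem norm_toLp_sq {X : Type*} [MeasurableSpace X] {ν : Measure X} {f : X → ℂ}
    (hf : MemLp f 2 ν) :
    ‖hf.toLp f‖ ^ 2 = ∫ x, ‖f x‖ ^ 2 ∂ν := by
  have := L2.inner_def (𝕜 := ℂ) (hf.toLp f) (hf.toLp f)
  rw [inner_self_eq_norm_sq_to_K] at this
  have h2 : ∫ x, inner ℂ (hf.toLp f x) (hf.toLp f x) ∂ν = ((∫ x, ‖f x‖ ^ 2 ∂ν : ℝ) : ℂ) := by
    rw [← integral_complex_ofReal]
    refine integral_congr_ae ?_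
    filter_upwards [hf.coeFn_toLp] with x hx
    rw [hx, inner_self_eq_norm_sq_to_K]
    norm_cast
  rw [h2] at this
  refine Complex.ofReal_injective ?_
  rw [← this]
  push_cast
  rfl

section RightRegular

variable {G : Type*} [Group G] [TopologicalSpace G] [IsTopologicalGroup G]
  [LocallyCompactSpace G] [SecondCountableTopology G] [T2Space G]
  [MeasurableSpace G] [BorelSpace G] (lam : Measure G) [lam.IsHaarMeasure]

theorem coeFn_rightRegular (g : G) (f : L2 lam) :
    rightRegular lam g f =ᵐ[lam] fun x => ((rightFactor g : ℝ) : ℂ) * f (x * g) := by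
  exact (memLp_rightTranslate lam g f).coeFn_toLp

omit [SecondCountableTopology G] [T2Space G] [MeasurableSpace G] [BorelSpace G] in
theorem rightFactor_mul (g h : G) : rightFactor (g * h) = rightFactor g * rightFactor h := by
  simp [rightFactor, Measure.modularCharacterFun_map_mul, NNReal.sqrt_mul, mul_comm]

omit [SecondCountableTopology G] [T2Space G] [MeasurableSpace G] [BorelSpace G] in
theorem rightFactor_one : rightFactor (1 : G) = 1 := by
  simp [rightFactor, Measure.modularCharacterFun_map_one]

theorem rightRegular_mul_apply (g h : G) (f : L2 lam) :
    rightRegular lam (g * h) f = rightRegular lam g (rightRegular lam h f) := by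
  refine Lp.ext ?_
  filter_upwards [coeFn_rightRegular lam (g * h) f, coeFn_rightRegular lam g (rightRegular lam h f),
    (quasiMeasurePreserving_rightTranslate lam g).ae (coeFn_rightRegular lam h f)] with x h1 h2 h3
  rw [h1, h2, h3, rightFactor_mul]
  push_cast
  rw [mul_assoc, mul_assoc x g h]

theorem rightRegular_one_apply (f : L2 lam) : rightRegular lam 1 f = f := by
  refine Lp.ext ?_
  filter_upwards [coeFn_rightRegular lam 1 f] with x h1
  rw [h1]
  simp [rightFactor_one]

theorem rightRegular_apply_inv_apply (g : G) (f : L2 lam) :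
    rightRegular lam g (rightRegular lam g⁻¹ f) = f := by
  rw [← rightRegular_mul_apply, mul_inv_cancel, rightRegular_one_apply]

theorem rightRegular_inv_apply_apply (g : G) (f : L2 lam) :
    rightRegular lam g⁻¹ (rightRegular lam g f) = f := by
  rw [← rightRegular_mul_apply, inv_mul_cancel, rightRegular_one_apply]

theorem inner_rightRegular_right (g : G) (p q : L2 lam) :
    inner ℂ p (rightRegular lam g q) = inner ℂ (rightRegular lam g⁻¹ p) q := by
  rw [← (rightRegular lam g⁻¹).inner_map_map p, rightRegular_inv_apply_apply]

theorem conjAction_apply (g : G) (A : L2 lam →L[ℂ] L2 lam) (f : L2 lam) :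
    conjAction lam g A f = rightRegular lam g (A (rightRegular lam g⁻¹ f)) := rfl

theorem norm_conjAction_le (g : G) (A : L2 lam →L[ℂ] L2 lam) : ‖conjAction lam g A‖ ≤ ‖A‖ := by
  refine ContinuousLinearMap.opNorm_le_bound _ (norm_nonneg _) fun f => ?_
  rw [conjAction_apply, LinearIsometry.norm_map]
  exact (A.le_opNorm _).trans_eq (by rw [LinearIsometry.norm_map])

/-- Dominated convergence for the right translates of a continuous compactly supported
function near the identity. -/
theorem tendsto_integral_rightTranslate {E : Type*} [NormedAddCommGroup E] {f : G → E}
    (hf : Continuous f) (hs : HasCompactSupport f) {c : G → ℝ} (hc : ContinuousAt c 1)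
    {Ψ : ℝ → E → E → ℝ} (hΨ : Continuous fun z : ℝ × E × E => Ψ z.1 z.2.1 z.2.2)
    (hΨ0 : ∀ t, Ψ t 0 0 = 0) :
    Tendsto (fun g => ∫ x, Ψ (c g) (f (x * g)) (f x) ∂lam) (𝓝 1)
      (𝓝 (∫ x, Ψ (c 1) (f x) (f x) ∂lam)) := by
  obtain ⟨V, hV, hV1⟩ := exists_compact_mem_nhds (1 : G)
  set L : Set G := (fun z : G × G => z.1 * z.2⁻¹) '' (tsupport f ×ˢ V) ∪ tsupport f
  have hL : IsCompact L :=
    ((hs.isCompact.prod hV).image (by fun_prop)).union hs.isCompact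
  -- the range of `f` is compact, so that `Ψ` is bounded on the relevant values
  have hR : IsCompact (insert 0 (f '' tsupport f)) := (hs.isCompact.image hf).insert 0
  have hfR : ∀ x, f x ∈ insert 0 (f '' tsupport f) := by
    intro x
    by_cases hx : x ∈ tsupport f
    · exact Or.inr ⟨x, hx, rfl⟩
    · exact Or.inl (image_eq_zero_of_notMem_tsupport hx)
  obtain ⟨B, hB⟩ := ((isCompact_Icc (a := c 1 - 1) (b := c 1 + 1)).prod
    (hR.prod hR)).exists_bound_of_continuousOn hΨ.continuousOn
  have hcI : ∀ᶠ g in 𝓝 (1 : G), c g ∈ Set.Icc (c 1 - 1) (c 1 + 1) :=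
    hc.eventually_mem (Icc_mem_nhds (by linarith) (by linarith))
  refine tendsto_integral_filter_of_dominated_convergence (L.indicator fun _ => B) ?_ ?_ ?_ ?_
  · refine Eventually.of_forall fun g => Continuous.aestronglyMeasurable ?_
    exact hΨ.comp (by fun_prop : Continuous fun x : G => (c g, f (x * g), f x))
  · filter_upwards [hV1, hcI] with g hg hcg
    refine Eventually.of_forall fun x => ?_
    by_cases hx : x ∈ L
    · rw [Set.indicator_of_mem hx]
      exact hB (c g, f (x * g), f x) ⟨hcg, hfR _, hfR _⟩
    · have h1 : f x = 0 := image_eq_zero_of_notMem_tsupport fun h => hx (Or.inr h)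
      have h2 : f (x * g) = 0 := image_eq_zero_of_notMem_tsupport fun h =>
        hx (Or.inl ⟨(x * g, g), ⟨h, hg⟩, by simp⟩)
      simp [h1, h2, hΨ0, hx]
  · exact (integrable_indicator_iff hL.measurableSet).2 (integrableOn_const hL.measure_lt_top.ne)
  · refine Eventually.of_forall fun x => ?_
    have h1 : Tendsto (fun g => f (x * g)) (𝓝 1) (𝓝 (f x)) := by
      have : Continuous fun g => f (x * g) := by fun_prop
      simpa using this.tendsto 1
    exact (hΨ.tendsto (c 1, f x, f x)).comp
      (hc.tendsto.prodMk_nhds (h1.prodMk_nhds tendsto_const_nhds))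

include lam in
/-- The modular character is continuous at the identity, since it is the factor by which right
translation changes the integral of a continuous compactly supported function. -/
theorem continuousAt_modularCharacterFun :
    ContinuousAt (fun g : G => (Measure.modularCharacterFun g : ℝ)) 1 := by
  obtain ⟨f, hs, hnn, hf1⟩ := exists_continuous_nonneg_pos (1 : G)
  have hpos : 0 < ∫ x, f x ∂lam :=
    f.continuous.integral_pos_of_hasCompactSupport_nonneg_nonzero hs hnn hf1
  have h := tendsto_integral_rightTranslate lam f.continuous hs (c := fun _ => 1)
    continuousAt_const (Ψ := fun _ y _ => y) (by fun_prop) (fun _ => rfl)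
  have he : ∀ g : G, ∫ x, f (x * g) ∂lam = Measure.modularCharacterFun g * ∫ x, f x ∂lam := by
    intro g
    have hm := Measure.map_right_mul_eq_modularCharacterFun_smul lam g
    rw [← integral_map (φ := fun x => x * g) (measurable_mul_const g).aemeasurable
      f.continuous.aestronglyMeasurable, hm]
    exact integral_smul_nnreal_measure _ _
  simp only [he] at h
  have := h.div_const (∫ x, f x ∂lam)
  simp only [mul_div_cancel_right₀ _ hpos.ne', div_self hpos.ne'] at this
  simpa only [ContinuousAt, Measure.modularCharacterFun_map_one, NNReal.coe_one] using this

include lam in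
theorem continuousAt_rightFactor : ContinuousAt (fun g : G => (rightFactor g : ℝ)) 1 := by
  have h : (fun g : G => (rightFactor g : ℝ)) =
      fun g => Real.sqrt (Measure.modularCharacterFun g : ℝ)⁻¹ := by
    ext g; simp [rightFactor]
  rw [h]
  refine (ContinuousAt.inv₀ (continuousAt_modularCharacterFun lam) ?_).sqrt
  simp [Measure.modularCharacterFun_map_one]

theorem exists_hasCompactSupport_dist_lt (p : L2 lam) {ε : ℝ} (hε : 0 < ε) :
    ∃ (f : G → ℂ) (hf : MemLp f 2 lam), Continuous f ∧ HasCompactSupport f ∧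
      dist p (hf.toLp f) < ε := by
  obtain ⟨f, hs, hle, hc, hm⟩ := (Lp.memLp p).exists_hasCompactSupport_eLpNorm_sub_le
    (by simp) (ε := ENNReal.ofReal (ε / 2)) (by simpa using hε)
  refine ⟨f, hm, hc, hs, ?_⟩
  rw [dist_eq_norm]
  have : p - hm.toLp f = ((Lp.memLp p).sub hm).toLp _ := by
    rw [MemLp.toLp_sub (Lp.memLp p) hm, Lp.toLp_coeFn]
  rw [this, Lp.norm_toLp]
  have := ENNReal.toReal_mono ENNReal.ofReal_ne_top hle
  rw [ENNReal.toReal_ofReal (by positivity)] at this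
  linarith

/-- Strong continuity of the right regular representation at the identity. -/
theorem tendsto_rightRegular_one (p : L2 lam) :
    Tendsto (fun g => rightRegular lam g p) (𝓝 1) (𝓝 p) := by
  have hdense : ∀ (f : G → ℂ) (hf : MemLp f 2 lam), Continuous f → HasCompactSupport f →
      Tendsto (fun g => rightRegular lam g (hf.toLp f)) (𝓝 1) (𝓝 (hf.toLp f)) := by
    intro f hf hc hs
    rw [tendsto_iff_norm_sub_tendsto_zero]
    have h := tendsto_integral_rightTranslate lam hc hs (continuousAt_rightFactor lam)
      (Ψ := fun t y z => ‖(t : ℂ) * y - z‖ ^ 2) (by fun_prop) (by simp)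
    have he : ∀ g, ‖rightRegular lam g (hf.toLp f) - hf.toLp f‖ ^ 2 =
        ∫ x, ‖((rightFactor g : ℝ) : ℂ) * f (x * g) - f x‖ ^ 2 ∂lam := by
      intro g
      have hae : rightRegular lam g (hf.toLp f) - hf.toLp f =ᵐ[lam]
          fun x => ((rightFactor g : ℝ) : ℂ) * f (x * g) - f x := by
        filter_upwards [Lp.coeFn_sub (rightRegular lam g (hf.toLp f)) (hf.toLp f),
          coeFn_rightRegular lam g (hf.toLp f), hf.coeFn_toLp,
          (quasiMeasurePreserving_rightTranslate lam g).ae hf.coeFn_toLp] with x h1 h2 h3 h4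
        rw [h1, Pi.sub_apply, h2, h3, h4]
      have hm := (memLp_congr_ae hae).1 (Lp.memLp _)
      rw [← norm_toLp_sq hm]
      congr 2
      rw [← Lp.toLp_coeFn (rightRegular lam g (hf.toLp f) - hf.toLp f) (Lp.memLp _)]
      exact MemLp.toLp_congr _ _ hae
    simp only [← he] at h
    have h2 := h.sqrt
    simp only [Real.sqrt_sq (norm_nonneg _)] at h2
    simpa [rightFactor_one] using h2
  rw [Metric.tendsto_nhds]
  intro ε hε
  obtain ⟨f, hf, hc, hs, hd⟩ := exists_hasCompactSupport_dist_lt lam p (ε := ε / 3) (by positivity)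
  filter_upwards [Metric.tendsto_nhds.1 (hdense f hf hc hs) (ε / 3) (by positivity)] with g hg
  have h1 := dist_triangle4 (rightRegular lam g p) (rightRegular lam g (hf.toLp f)) (hf.toLp f) p
  rw [LinearIsometry.dist_map, dist_comm (hf.toLp f) p] at h1
  linarith

theorem continuous_rightRegular (p : L2 lam) : Continuous fun g => rightRegular lam g p := by
  rw [continuous_iff_continuousAt]
  intro g
  have h1 : Tendsto (fun h => rightRegular lam g (rightRegular lam (g⁻¹ * h) p)) (𝓝 g)
      (𝓝 (rightRegular lam g p)) := by
    refine ((rightRegular lam g).continuous.tendsto p).comp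
      ((tendsto_rightRegular_one lam p).comp ?_)
    have : Continuous fun h => g⁻¹ * h := by fun_prop
    simpa using this.tendsto g
  refine h1.congr fun h => ?_
  rw [← rightRegular_mul_apply, mul_inv_cancel_left]

/-- The matrix coefficients of the right regular representation vanish at infinity: for compactly
supported functions they have compact support, and these functions are dense. -/
theorem tendsto_inner_rightRegular_cocompact (p q : L2 lam) :
    Tendsto (fun g => inner ℂ p (rightRegular lam g q)) (cocompact G) (𝓝 0) := by
  rw [Metric.tendsto_nhds]
  intro ε hε
  set δ := ε / (‖p‖ + ‖q‖ + 2) with hδ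
  have hδ0 : 0 < δ := by positivity
  obtain ⟨f, hf, hc, hs, hd⟩ := exists_hasCompactSupport_dist_lt lam p (ε := min δ 1)
    (by positivity)
  obtain ⟨h, hh, hc', hs', hd'⟩ := exists_hasCompactSupport_dist_lt lam q (ε := δ) hδ0
  have hK : IsCompact ((fun z : G × G => z.1⁻¹ * z.2) '' (tsupport f ×ˢ tsupport h)) :=
    (hs.isCompact.prod hs'.isCompact).image (by fun_prop)
  filter_upwards [hK.compl_mem_cocompact] with g hg
  have hzero : inner ℂ (hf.toLp f) (rightRegular lam g (hh.toLp h)) = 0 := by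
    rw [L2.inner_def]
    refine integral_eq_zero_of_ae ?_
    filter_upwards [hf.coeFn_toLp, coeFn_rightRegular lam g (hh.toLp h),
      (quasiMeasurePreserving_rightTranslate lam g).ae hh.coeFn_toLp] with x h1 h2 h3
    rw [h1, h2, h3]
    by_cases hx : x ∈ tsupport f
    · have : h (x * g) = 0 := image_eq_zero_of_notMem_tsupport fun hxg =>
        hg ⟨(x, x * g), ⟨hx, hxg⟩, by simp⟩
      simp [this]
    · simp [image_eq_zero_of_notMem_tsupport hx]
  have hsplit : inner ℂ p (rightRegular lam g q) =
      inner ℂ (p - hf.toLp f) (rightRegular lam g q) +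
        inner ℂ (hf.toLp f) (rightRegular lam g (q - hh.toLp h)) := by
    rw [map_sub, inner_sub_left, inner_sub_right, hzero]
    ring
  rw [dist_eq_norm] at hd hd'
  have hfn : ‖hf.toLp f‖ ≤ ‖p‖ + 1 := by
    have := norm_sub_norm_le (hf.toLp f) p
    rw [norm_sub_rev] at this
    linarith [hd.trans_le (min_le_right _ _)]
  rw [dist_zero_right, hsplit]
  calc _ ≤ ‖p - hf.toLp f‖ * ‖q‖ + ‖hf.toLp f‖ * ‖q - hh.toLp h‖ := by
        refine (norm_add_le _ _).trans (add_le_add ?_ ?_) <;>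
        refine (norm_inner_le_norm _ _).trans_eq (by rw [LinearIsometry.norm_map])
    _ ≤ δ * ‖q‖ + (‖p‖ + 1) * δ := by
        gcongr
        exact hd.le.trans (min_le_left _ _)
    _ = δ * (‖p‖ + ‖q‖ + 1) := by ring
    _ < δ * (‖p‖ + ‖q‖ + 2) := by gcongr; norm_num
    _ = ε := by rw [hδ]; field_simp

theorem rankOne_mem_vanishingOperators (x y : L2 lam) :
    rankOne ℂ x y ∈ vanishingOperators lam := by
  intro T hT
  have h : Tendsto (fun g => trace (T ∘L conjAction lam g (rankOne ℂ x y))) (cocompact G)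
      (𝓝 (trace (T ∘L 0))) := by
    refine tendsto_trace_of_tendsto_inner hT (fun g => norm_conjAction_le lam g _) fun p q => ?_
    have he : ∀ g, inner ℂ p (conjAction lam g (rankOne ℂ x y) q) =
        inner ℂ (rightRegular lam g y) q * inner ℂ p (rightRegular lam g x) := by
      intro g
      have := inner_rightRegular_right lam g⁻¹ y q
      rw [inv_inv] at this
      rw [conjAction_apply, rankOne_apply, map_smul, inner_smul_right, this]
    simp only [he]
    have h1 := (tendsto_inner_rightRegular_cocompact lam q y).star
    simp only [RCLike.star_def, inner_conj_symm, star_zero] at h1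
    simpa using h1.mul (tendsto_inner_rightRegular_cocompact lam p x)
  simpa [trace] using h

end RightRegular

/-! ### Multiplication operators and coefficients -/

section Multiplication

variable {X : Type*} [TopologicalSpace X] [MeasurableSpace X] [BorelSpace X] (ν : Measure X)

theorem memLp_mul (φ : X →ᵇ ℂ) (f : Lp ℂ 2 ν) : MemLp (fun x => φ x * f x) 2 ν :=
  (Lp.memLp f).of_le_mul (c := ‖φ‖)
    (φ.continuous.aestronglyMeasurable.mul (Lp.aestronglyMeasurable f))
    (Eventually.of_forall fun x => by rw [norm_mul]; gcongr; exact φ.norm_coe_le_norm x)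

/-- The multiplication operators on `L²` given by bounded continuous functions. -/
noncomputable def mulOp : (X →ᵇ ℂ) →L[ℂ] Lp ℂ 2 ν →L[ℂ] Lp ℂ 2 ν :=
  LinearMap.mkContinuous₂
    (LinearMap.mk₂ ℂ (fun φ f => (memLp_mul ν φ f).toLp)
      (fun φ₁ φ₂ f => by
        rw [← MemLp.toLp_add, MemLp.toLp_eq_toLp_iff]
        exact Eventually.of_forall fun x => by simp [add_mul])
      (fun c φ f => by
        rw [← MemLp.toLp_const_smul, MemLp.toLp_eq_toLp_iff]
        exact Eventually.of_forall fun x => by simp [mul_assoc])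
      (fun φ f₁ f₂ => by
        rw [← MemLp.toLp_add, MemLp.toLp_eq_toLp_iff]
        filter_upwards [Lp.coeFn_add f₁ f₂] with x hx
        rw [Pi.add_apply, hx, Pi.add_apply, mul_add])
      (fun c φ f => by
        rw [← MemLp.toLp_const_smul, MemLp.toLp_eq_toLp_iff]
        filter_upwards [Lp.coeFn_smul c f] with x hx
        rw [Pi.smul_apply, hx, Pi.smul_apply, smul_eq_mul, smul_eq_mul, mul_left_comm]))
    1 (fun φ f => by
      rw [one_mul]
      refine Lp.norm_le_mul_norm_of_ae_le_mul ?_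
      filter_upwards [(memLp_mul ν φ f).coeFn_toLp] with x hx
      rw [LinearMap.mk₂_apply, hx, norm_mul]
      gcongr
      exact φ.norm_coe_le_norm x)

theorem coeFn_mulOp (φ : X →ᵇ ℂ) (f : Lp ℂ 2 ν) :
    mulOp ν φ f =ᵐ[ν] fun x => φ x * f x :=
  (memLp_mul ν φ f).coeFn_toLp

theorem norm_mulOp_le (φ : X →ᵇ ℂ) : ‖mulOp ν φ‖ ≤ ‖φ‖ := by
  refine ((mulOp ν).le_of_opNorm_le (LinearMap.mkContinuous₂_norm_le _ zero_le_one _) φ).trans_eq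
    (one_mul _)

/-- If the measure charges every nonempty open set, then the supremum of a continuous function is
its essential supremum, which is bounded by the norm of the multiplication operator. -/
theorem norm_apply_le_norm_mulOp [LocallyCompactSpace X] [T2Space X] [ν.IsOpenPosMeasure]
    [IsFiniteMeasureOnCompacts ν] (φ : X →ᵇ ℂ) (x : X) : ‖φ x‖ ≤ ‖mulOp ν φ‖ := by
  by_contra! hlt
  obtain ⟨r, hr, hrx⟩ := exists_between hlt
  have hU : {y | r < ‖φ y‖} ∈ 𝓝 x :=
    (isOpen_lt continuous_const φ.continuous.norm).mem_nhds hrx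
  obtain ⟨K, hKx, hKU, hK⟩ := local_compact_nhds hU
  have hKpos : 0 < ν K := Measure.measure_pos_of_mem_nhds ν hKx
  set f : Lp ℂ 2 ν := indicatorConstLp 2 hK.measurableSet hK.measure_lt_top.ne (1 : ℂ)
  have hf : 0 < ‖f‖ := by
    rw [norm_indicatorConstLp (by simp) (by simp), norm_one, one_mul]
    exact Real.rpow_pos_of_pos (ENNReal.toReal_pos hKpos.ne' hK.measure_lt_top.ne) _
  have hr0 : 0 ≤ r := (norm_nonneg _).trans hr.le
  have h1 : ‖(r : ℂ) • f‖ ≤ ‖mulOp ν φ f‖ := by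
    refine Lp.norm_le_norm_of_ae_le ?_
    filter_upwards [Lp.coeFn_smul (r : ℂ) f, coeFn_mulOp ν φ f,
      (indicatorConstLp_coeFn : f =ᵐ[ν] _)] with y h1 h2 h3
    rw [h1, h2, Pi.smul_apply, smul_eq_mul, norm_mul, norm_mul, h3, Complex.norm_real,
      Real.norm_of_nonneg hr0]
    by_cases hy : y ∈ K
    · gcongr
      exact (hKU hy : r < ‖φ y‖).le
    · simp [hy]
  rw [norm_smul, Complex.norm_real, Real.norm_of_nonneg hr0] at h1
  have h2 := h1.trans ((mulOp ν φ).le_opNorm f)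
  exact absurd (le_of_mul_le_mul_right h2 hf) (not_le.2 hr)

end Multiplication

section Coefficients

variable {G : Type*} [Group G] [TopologicalSpace G] [IsTopologicalGroup G]
  [LocallyCompactSpace G] [SecondCountableTopology G] [T2Space G]
  [MeasurableSpace G] [BorelSpace G] (lam : Measure G) [lam.IsHaarMeasure]

theorem norm_inner_orbit_le (p q : L2 lam) (A : L2 lam →L[ℂ] L2 lam) (x : G) :
    ‖inner ℂ (rightRegular lam x⁻¹ p) (A (rightRegular lam x⁻¹ q))‖ ≤ ‖A‖ * (‖p‖ * ‖q‖) := by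
  simpa only [LinearIsometry.norm_map] using norm_inner_apply_le A
    (rightRegular lam x⁻¹ p) (rightRegular lam x⁻¹ q)

/-- The coefficient `x ↦ ⟪p, (π(x) A) q⟫` of one operator `A`; see `coefficient`. -/
noncomputable def coefficientFun (p q : L2 lam) (A : L2 lam →L[ℂ] L2 lam) : G →ᵇ ℂ :=
  ofNormedAddCommGroup
    (fun x => inner ℂ (rightRegular lam x⁻¹ p) (A (rightRegular lam x⁻¹ q)))
    (((continuous_rightRegular lam p).comp continuous_inv).inner
      (A.continuous.comp ((continuous_rightRegular lam q).comp continuous_inv)))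
    (‖A‖ * (‖p‖ * ‖q‖)) (norm_inner_orbit_le lam p q A)

theorem coefficientFun_apply (p q : L2 lam) (A : L2 lam →L[ℂ] L2 lam) (x : G) :
    coefficientFun lam p q A x =
      inner ℂ (rightRegular lam x⁻¹ p) (A (rightRegular lam x⁻¹ q)) := rfl

/-- The coefficient `x ↦ ⟪p, (π(x) A) q⟫` of an operator `A`, a bounded continuous function
on `G`, depends linearly and continuously on `A`. -/
noncomputable def coefficient (p q : L2 lam) : (L2 lam →L[ℂ] L2 lam) →L[ℂ] (G →ᵇ ℂ) :=
  LinearMap.mkContinuous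
    { toFun := coefficientFun lam p q
      map_add' := fun A B => by
        ext x
        simp only [coefficientFun_apply, BoundedContinuousFunction.add_apply, _root_.add_apply,
          inner_add_right]
      map_smul' := fun c A => by
        ext x
        simp only [coefficientFun_apply, BoundedContinuousFunction.smul_apply, RingHom.id_apply,
          _root_.smul_apply, inner_smul_right, smul_eq_mul] }
    (‖p‖ * ‖q‖) (fun A =>
      (norm_ofNormedAddCommGroup_le _ (by positivity)
        (norm_inner_orbit_le lam p q A)).trans_eq (mul_comm _ _))

theorem coefficient_apply (p q : L2 lam) (A : L2 lam →L[ℂ] L2 lam) (x : G) :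
    coefficient lam p q A x = inner ℂ (rightRegular lam x⁻¹ p) (A (rightRegular lam x⁻¹ q)) := rfl

theorem coefficient_apply_eq_trace (p q : L2 lam) (A : L2 lam →L[ℂ] L2 lam) (x : G) :
    coefficient lam p q A x = trace (rankOne ℂ q p ∘L conjAction lam x A) := by
  rw [trace_rankOne_comp, conjAction_apply, inner_rightRegular_right, coefficient_apply]

theorem coefficient_apply_one (p q : L2 lam) (A : L2 lam →L[ℂ] L2 lam) :
    coefficient lam p q A 1 = inner ℂ p (A q) := by
  rw [coefficient_apply, inv_one, rightRegular_one_apply, rightRegular_one_apply]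

theorem coefficient_rightRegular (p q : L2 lam) (A : L2 lam →L[ℂ] L2 lam) (g x : G) :
    coefficient lam (rightRegular lam g⁻¹ p) (rightRegular lam g⁻¹ q) A x =
      coefficient lam p q A (g * x) := by
  simp only [coefficient_apply, ← rightRegular_mul_apply, mul_inv_rev]

theorem coefficient_conjAction (p q : L2 lam) (A : L2 lam →L[ℂ] L2 lam) (g x : G) :
    coefficient lam p q (conjAction lam g A) x = coefficient lam p q A (x * g) := by
  rw [coefficient_apply, conjAction_apply, inner_rightRegular_right, coefficient_apply]
  simp only [← rightRegular_mul_apply, mul_inv_rev]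

/-- The operator `A ↦ M` on `B(L²(G))`, where `M` is the multiplication by the coefficient
`x ↦ ⟪p, (π(x) A) q⟫`. -/
noncomputable def coefficientMul (p q : L2 lam) :
    (L2 lam →L[ℂ] L2 lam) →L[ℂ] (L2 lam →L[ℂ] L2 lam) :=
  mulOp lam ∘L coefficient lam p q

/-- Both `π(g)` and the passage to coefficients act by right translation of functions. -/
theorem coefficientMul_conjAction (p q : L2 lam) (g : G) (A : L2 lam →L[ℂ] L2 lam) :
    coefficientMul lam p q (conjAction lam g A) = conjAction lam g (coefficientMul lam p q A) := by
  ext1 f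
  refine Lp.ext ?_
  have h0 := coeFn_mulOp lam (coefficient lam p q A) (rightRegular lam g⁻¹ f)
  have h4 := coeFn_rightRegular lam g (rightRegular lam g⁻¹ f)
  rw [rightRegular_apply_inv_apply] at h4
  filter_upwards [coeFn_mulOp lam (coefficient lam p q (conjAction lam g A)) f,
    coeFn_rightRegular lam g (mulOp lam (coefficient lam p q A) (rightRegular lam g⁻¹ f)),
    (quasiMeasurePreserving_rightTranslate lam g).ae h0, h4] with x h1 h2 h3 h4
  rw [conjAction_apply, coefficientMul, ContinuousLinearMap.comp_apply,
    ContinuousLinearMap.comp_apply, h1, h2, h3, h4, coefficient_conjAction]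
  ring

end Coefficients

/-! ### Weak* continuity via Parseval's identity -/

section Parseval

variable {H : Type*} [NormedAddCommGroup H] [InnerProductSpace ℂ H]

theorem countable_of_hilbertBasis [TopologicalSpace.SeparableSpace H] {ι : Type*}
    (b : HilbertBasis ι ℂ H) : Countable ι := by
  classical
  refine Pairwise.countable_of_isOpen_disjoint (s := fun i => Metric.ball (b i) (1 / 2)) ?_
    (fun i => Metric.isOpen_ball) (fun i => Metric.nonempty_ball.2 (by norm_num))
  intro i j hij
  refine Metric.ball_disjoint_ball ?_
  have h1 := norm_sub_sq (𝕜 := ℂ) (b i) (b j)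
  rw [b.orthonormal.norm_eq_one, b.orthonormal.norm_eq_one,
    orthonormal_iff_ite.1 b.orthonormal i j] at h1
  simp only [hij, if_false] at h1
  rw [dist_eq_norm]
  norm_num at h1 ⊢
  nlinarith [norm_nonneg (b i - b j)]

theorem tsum_enorm_inner_sq {ι : Type*} (b : HilbertBasis ι ℂ H) (x : H) :
    ∑' i, ‖inner ℂ (b i) x‖ₑ ^ 2 = ‖x‖ₑ ^ 2 := by
  have h := hasSum_norm_inner_sq b x
  have h2 := ENNReal.ofReal_tsum_of_nonneg (fun i => sq_nonneg ‖inner ℂ (b i) x‖) h.summable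
  rw [h.tsum_eq] at h2
  simpa only [ENNReal.ofReal_pow (norm_nonneg _), ofReal_norm] using h2.symm

/-- Polarization of a Parseval identity. -/
theorem hasSum_inner_of_hasSum_norm_sq {E ι : Type*} [NormedAddCommGroup E] [InnerProductSpace ℂ E]
    {J : ι → E →ₗ[ℂ] H} (hJ : ∀ x, HasSum (fun i => ‖J i x‖ ^ 2) (‖x‖ ^ 2)) (x y : E) :
    HasSum (fun i => inner ℂ (J i x) (J i y)) (inner ℂ x y) := by
  have hc : ∀ z, HasSum (fun i => ((‖J i z‖ : ℂ)) ^ 2) ((‖z‖ : ℂ) ^ 2) := fun z => by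
    have := Complex.hasSum_ofReal.2 (hJ z)
    push_cast at this
    exact this
  have h := ((((hc (x + y)).sub (hc (x - y))).add
    (((hc (x - Complex.I • y)).sub (hc (x + Complex.I • y))).mul_right Complex.I)).div_const 4)
  have hi : ∀ i, inner ℂ (J i x) (J i y) =
      (((‖J i (x + y)‖ : ℂ) ^ 2 - (‖J i (x - y)‖ : ℂ) ^ 2 +
        ((‖J i (x - Complex.I • y)‖ : ℂ) ^ 2 - (‖J i (x + Complex.I • y)‖ : ℂ) ^ 2) *
          Complex.I) / 4) := fun i => by
    rw [inner_eq_sum_norm_sq_div_four]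
    simp
  have he : inner ℂ x y =
      (((‖x + y‖ : ℂ) ^ 2 - (‖x - y‖ : ℂ) ^ 2 +
        ((‖x - Complex.I • y‖ : ℂ) ^ 2 - (‖x + Complex.I • y‖ : ℂ) ^ 2) * Complex.I) / 4) :=
    inner_eq_sum_norm_sq_div_four x y
  rw [he, funext hi]
  exact h

variable {α : Type*} [MeasurableSpace α] {ν : Measure α}

theorem enorm_sq_eq_lintegral {E : Type*} [NormedAddCommGroup E] (F : Lp E 2 ν) :
    ‖F‖ₑ ^ 2 = ∫⁻ x, ‖F x‖ₑ ^ 2 ∂ν := by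
  have := eLpNorm_nnreal_pow_eq_lintegral (μ := ν) (f := F) (p := 2) (by norm_num)
  rw [Lp.enorm_def]
  simpa using this

theorem integrable_star_smul (u : Lp ℂ 2 ν) (F : Lp H 2 ν) :
    Integrable (fun x => (starRingEnd ℂ) (u x) • F x) ν := by
  have hu : MemLp (fun x => (starRingEnd ℂ) (u x)) 2 ν := (Lp.memLp u).star
  exact memLp_one_iff_integrable.1 ((Lp.memLp F).smul hu)

/-- The coordinate `∫ conj (u x) F(x) dx` of a vector-valued square integrable function. -/
noncomputable def vectorCoordinate (u : Lp ℂ 2 ν) : Lp H 2 ν →ₗ[ℂ] H where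
  toFun F := ∫ x, (starRingEnd ℂ) (u x) • F x ∂ν
  map_add' F₁ F₂ := by
    rw [← integral_add (integrable_star_smul u F₁) (integrable_star_smul u F₂)]
    refine integral_congr_ae ?_
    filter_upwards [Lp.coeFn_add F₁ F₂] with x hx
    rw [hx, Pi.add_apply, smul_add]
  map_smul' c F := by
    rw [RingHom.id_apply, ← integral_smul]
    refine integral_congr_ae ?_
    filter_upwards [Lp.coeFn_smul c F] with x hx
    rw [hx, Pi.smul_apply, smul_comm]

theorem vectorCoordinate_apply (u : Lp ℂ 2 ν) (F : Lp H 2 ν) :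
    vectorCoordinate u F = ∫ x, (starRingEnd ℂ) (u x) • F x ∂ν := rfl

variable [CompleteSpace H]

theorem vectorCoordinate_compLp (u : Lp ℂ 2 ν) (A : H →L[ℂ] H) (F : Lp H 2 ν) :
    vectorCoordinate u (A.compLp F) = A (vectorCoordinate u F) := by
  rw [vectorCoordinate_apply, vectorCoordinate_apply,
    ← A.integral_comp_comm (integrable_star_smul u F)]
  refine integral_congr_ae ?_
  filter_upwards [A.coeFn_compLp F] with x hx
  rw [hx, map_smul]

theorem inner_vectorCoordinate (e : H) (u : Lp ℂ 2 ν) (F : Lp H 2 ν) :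
    inner ℂ e (vectorCoordinate u F) = inner ℂ u ((innerSL ℂ e).compLp F) := by
  rw [vectorCoordinate_apply, ← integral_inner (integrable_star_smul u F), L2.inner_def]
  refine integral_congr_ae ?_
  filter_upwards [(innerSL ℂ e).coeFn_compLp F] with x hx
  rw [hx, inner_smul_right, innerSL_apply_apply, RCLike.inner_apply]
  ring

/-- Parseval's identity for Hilbert space valued functions: expand the values in a basis and
interchange the sums. -/
theorem tsum_enorm_vectorCoordinate_sq [TopologicalSpace.SeparableSpace H] {ι : Type*}
    (u : HilbertBasis ι ℂ (Lp ℂ 2 ν)) (F : Lp H 2 ν) :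
    ∑' j, ‖vectorCoordinate (u j) F‖ₑ ^ 2 = ‖F‖ₑ ^ 2 := by
  obtain ⟨w, b, -⟩ := exists_hilbertBasis ℂ H
  have := countable_of_hilbertBasis b
  calc ∑' j, ‖vectorCoordinate (u j) F‖ₑ ^ 2
      = ∑' j, ∑' i, ‖inner ℂ (u j) ((innerSL ℂ (b i)).compLp F)‖ₑ ^ 2 := by
        refine tsum_congr fun j => ?_
        rw [← tsum_enorm_inner_sq b]
        simp only [inner_vectorCoordinate]
    _ = ∑' i, ∑' j, ‖inner ℂ (u j) ((innerSL ℂ (b i)).compLp F)‖ₑ ^ 2 := ENNReal.tsum_comm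
    _ = ∑' i, ∫⁻ x, ‖inner ℂ (b i) (F x)‖ₑ ^ 2 ∂ν := by
        refine tsum_congr fun i => ?_
        rw [tsum_enorm_inner_sq u, enorm_sq_eq_lintegral]
        refine lintegral_congr_ae ?_
        filter_upwards [(innerSL ℂ (b i)).coeFn_compLp F] with x hx
        rw [hx, innerSL_apply_apply]
    _ = ∫⁻ x, ∑' i, ‖inner ℂ (b i) (F x)‖ₑ ^ 2 ∂ν := by
        refine (lintegral_tsum fun i => ?_).symm
        exact ((Lp.aestronglyMeasurable F).const_inner).enorm.pow_const 2
    _ = ‖F‖ₑ ^ 2 := by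
        simp only [tsum_enorm_inner_sq, enorm_sq_eq_lintegral]

theorem hasSum_norm_vectorCoordinate_sq [TopologicalSpace.SeparableSpace H] {ι : Type*}
    (u : HilbertBasis ι ℂ (Lp ℂ 2 ν)) (F : Lp H 2 ν) :
    HasSum (fun j => ‖vectorCoordinate (u j) F‖ ^ 2) (‖F‖ ^ 2) := by
  have h := tsum_enorm_vectorCoordinate_sq u F
  have h1 := ENNReal.hasSum_toReal (f := fun j => ‖vectorCoordinate (u j) F‖ₑ ^ 2)
    (by rw [h]; simp)
  rw [← ENNReal.tsum_toReal_eq (fun j => by simp), h] at h1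
  simpa using h1

end Parseval

section WeakStar

variable {G : Type*} [Group G] [TopologicalSpace G] [IsTopologicalGroup G]
  [LocallyCompactSpace G] [SecondCountableTopology G] [T2Space G]
  [MeasurableSpace G] [BorelSpace G] (lam : Measure G) [lam.IsHaarMeasure]

instance separableSpace_L2 : TopologicalSpace.SeparableSpace (L2 lam) := by
  have : Fact ((2 : ℝ≥0∞) ≠ ∞) := ⟨by simp⟩
  infer_instance

theorem memLp_smul_orbit (p ξ : L2 lam) :
    MemLp (fun x => ξ x • rightRegular lam x⁻¹ p) 2 lam :=
  (Lp.memLp ξ).of_le_mul (c := ‖p‖)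
    ((Lp.aestronglyMeasurable ξ).smul
      ((continuous_rightRegular lam p).comp continuous_inv).aestronglyMeasurable)
    (Eventually.of_forall fun x => by
      rw [norm_smul, LinearIsometry.norm_map, mul_comm])

/-- The vector-valued function `x ↦ ξ(x) ρ(x⁻¹) p`. -/
noncomputable def smulOrbit (p ξ : L2 lam) : Lp (L2 lam) 2 lam :=
  (memLp_smul_orbit lam p ξ).toLp

theorem coeFn_smulOrbit (p ξ : L2 lam) :
    smulOrbit lam p ξ =ᵐ[lam] fun x => ξ x • rightRegular lam x⁻¹ p :=
  (memLp_smul_orbit lam p ξ).coeFn_toLp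

theorem norm_smulOrbit_le (p ξ : L2 lam) : ‖smulOrbit lam p ξ‖ ≤ ‖p‖ * ‖ξ‖ := by
  refine Lp.norm_le_mul_norm_of_ae_le_mul ?_
  filter_upwards [coeFn_smulOrbit lam p ξ] with x hx
  rw [hx, norm_smul, LinearIsometry.norm_map, mul_comm]

/-- Both sides are the integral of `conj ξ(x) η(x) ⟪p, (π(x) A) q⟫`. -/
theorem inner_smulOrbit (p q ξ η : L2 lam) (A : L2 lam →L[ℂ] L2 lam) :
    inner ℂ (smulOrbit lam p ξ) (A.compLp (smulOrbit lam q η)) =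
      inner ℂ ξ (coefficientMul lam p q A η) := by
  rw [L2.inner_def (smulOrbit lam p ξ), L2.inner_def ξ]
  refine integral_congr_ae ?_
  filter_upwards [coeFn_smulOrbit lam p ξ, coeFn_smulOrbit lam q η,
    A.coeFn_compLp (smulOrbit lam q η), coeFn_mulOp lam (coefficient lam p q A) η]
    with x h1 h2 h3 h4
  rw [h3, h1, h2, coefficientMul, ContinuousLinearMap.comp_apply, h4, map_smul, inner_smul_left,
    inner_smul_right, RCLike.inner_apply, coefficient_apply]
  ring

theorem summable_vectorCoordinate_smulOrbit {ι : Type*} (u : HilbertBasis ι ℂ (L2 lam))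
    (p : L2 lam) {ξ : ℕ → L2 lam} (hξ : Summable fun n => ‖ξ n‖ ^ 2) :
    Summable fun z : ℕ × ι => ‖vectorCoordinate (u z.2) (smulOrbit lam p (ξ z.1))‖ ^ 2 := by
  have h : ∀ n, HasSum (fun j => ‖vectorCoordinate (u j) (smulOrbit lam p (ξ n))‖ ^ 2)
      (‖smulOrbit lam p (ξ n)‖ ^ 2) := fun n =>
    hasSum_norm_vectorCoordinate_sq (H := L2 lam) u (smulOrbit lam p (ξ n))
  refine (summable_prod_of_nonneg fun _ => sq_nonneg _).2 ⟨fun n => (h n).summable, ?_⟩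
  simp only [(h _).tsum_eq]
  refine Summable.of_nonneg_of_le (fun _ => sq_nonneg _) (fun n => ?_) (hξ.mul_left (‖p‖ ^ 2))
  rw [← mul_pow]
  gcongr
  exact norm_smulOrbit_le lam p _

/-- The predual of `coefficientMul` maps the trace class operator `∑ ⟪ξ n, ·⟫ η n` to
`∑ ∫ ⟪ξ n(x) ρ(x⁻¹) p, ·⟫ η n(x) ρ(x⁻¹) q dx`. Expanding the vector-valued functions in a basis
of `L²(G)` turns the integral into a sum of operators of rank one. -/
theorem isWeakStarContinuous_coefficientMul (p q : L2 lam) :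
    IsWeakStarContinuous (coefficientMul lam p q) := by
  refine isWeakStarContinuous_of_forall_exists _ fun T hT => ?_
  obtain ⟨ξ, η, hξ, hη, hs⟩ := hT
  obtain ⟨w, u, -⟩ := exists_hilbertBasis ℂ (L2 lam)
  have := countable_of_hilbertBasis u
  have ha := summable_vectorCoordinate_smulOrbit lam u p hξ
  have hb := summable_vectorCoordinate_smulOrbit lam u q hη
  obtain ⟨T', hT', htr⟩ := exists_isTraceClass_trace_comp ha hb
  refine ⟨T', hT', fun A => ?_⟩
  rw [htr, trace_comp_eq_tsum hξ hη hs]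
  have hsum : Summable fun z : ℕ × w =>
      inner ℂ (vectorCoordinate (u z.2) (smulOrbit lam p (ξ z.1)))
        (A (vectorCoordinate (u z.2) (smulOrbit lam q (η z.1)))) :=
    Summable.of_norm_bounded ((summable_norm_mul_norm ha hb).mul_left ‖A‖)
      fun z => norm_inner_apply_le _ _ _
  rw [hsum.tsum_prod]
  refine tsum_congr fun n => ?_
  have h := hasSum_inner_of_hasSum_norm_sq (hasSum_norm_vectorCoordinate_sq (H := L2 lam) u)
    (smulOrbit lam p (ξ n)) (A.compLp (smulOrbit lam q (η n)))
  simp only [vectorCoordinate_compLp, inner_smulOrbit] at h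
  exact h.tsum_eq.symm

end WeakStar

/-! ### Operators commuting with the commutant -/

section Commutant

variable {G : Type*} [Group G] [TopologicalSpace G] [IsTopologicalGroup G]
  [LocallyCompactSpace G] [SecondCountableTopology G] [T2Space G]
  [MeasurableSpace G] [BorelSpace G] {lam : Measure G} [lam.IsHaarMeasure]

theorem CommutesWithCommutant.mulOp_coefficient
    {S : (L2 lam →L[ℂ] L2 lam) →L[ℂ] (L2 lam →L[ℂ] L2 lam)} (hS : CommutesWithCommutant lam S)
    (p q : L2 lam) (A : L2 lam →L[ℂ] L2 lam) :
    S (mulOp lam (coefficient lam p q A)) = mulOp lam (coefficient lam p q (S A)) :=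
  hS (coefficientMul lam p q) (isWeakStarContinuous_coefficientMul lam p q)
    (coefficientMul_conjAction lam p q) A

/-- A uniform bound on a linear combination of left translates of a coefficient of `A` bounds the
same combination of values of the coefficient of `S A`. -/
theorem CommutesWithCommutant.norm_sum_coefficient_le
    {S : (L2 lam →L[ℂ] L2 lam) →L[ℂ] (L2 lam →L[ℂ] L2 lam)} (hS : CommutesWithCommutant lam S)
    (p q : L2 lam) (A : L2 lam →L[ℂ] L2 lam) (s : Finset G) (c : G → ℂ) {B : ℝ}
    (hB : ∀ x, ‖∑ g ∈ s, c g * coefficient lam p q A (g * x)‖ ≤ B) :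
    ‖∑ g ∈ s, c g * coefficient lam p q (S A) g‖ ≤ ‖S‖ * B := by
  set Θ : (L2 lam →L[ℂ] L2 lam) → (G →ᵇ ℂ) := fun A' => ∑ g ∈ s,
    c g • coefficient lam (rightRegular lam g⁻¹ p) (rightRegular lam g⁻¹ q) A' with hΘ
  have hval : ∀ A' x, Θ A' x = ∑ g ∈ s, c g * coefficient lam p q A' (g * x) := by
    intro A' x
    simp only [hΘ, BoundedContinuousFunction.coe_sum, Finset.sum_apply,
      BoundedContinuousFunction.smul_apply, smul_eq_mul, coefficient_rightRegular]
  have hSΘ : S (mulOp lam (Θ A)) = mulOp lam (Θ (S A)) := by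
    simp only [hΘ, map_sum, map_smul, hS.mulOp_coefficient]
  have hB0 : 0 ≤ B := (norm_nonneg _).trans (hB 1)
  have hΘB : ‖Θ A‖ ≤ B := (BoundedContinuousFunction.norm_le hB0).2 fun x => by
    rw [hval]; exact hB x
  calc ‖∑ g ∈ s, c g * coefficient lam p q (S A) g‖ = ‖Θ (S A) 1‖ := by simp only [hval, mul_one]
    _ ≤ ‖S (mulOp lam (Θ A))‖ := by
        rw [hSΘ]; exact norm_apply_le_norm_mulOp lam _ _
    _ ≤ ‖S‖ * ‖mulOp lam (Θ A)‖ := S.le_opNorm _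
    _ ≤ ‖S‖ * B := by
        gcongr
        exact (norm_mulOp_le lam _).trans hΘB

/-- If the coefficients of `A` vanish at infinity, then so do those of `S A`: otherwise a sum of `N`
almost disjointly supported translates of a coefficient of `A`, which is bounded independently of
`N`, would be mapped to a function of size proportional to `N`. -/
theorem CommutesWithCommutant.tendsto_coefficient
    {S : (L2 lam →L[ℂ] L2 lam) →L[ℂ] (L2 lam →L[ℂ] L2 lam)} (hS : CommutesWithCommutant lam S)
    {A : L2 lam →L[ℂ] L2 lam} (hA : A ∈ vanishingOperators lam) (p q : L2 lam) :
    Tendsto (coefficient lam p q (S A)) (cocompact G) (𝓝 0) := by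
  have hφ : Tendsto (coefficient lam p q A) (cocompact G) (𝓝 0) := by
    refine (hA _ (isTraceClass_rankOne p q)).congr fun x => ?_
    rw [coefficient_apply_eq_trace]
  by_contra hcon
  obtain ⟨ε, hε, hfr⟩ : ∃ ε > 0, ∃ᶠ g in cocompact G, ε ≤ ‖coefficient lam p q (S A) g‖ := by
    rw [Metric.tendsto_nhds] at hcon
    push Not at hcon
    obtain ⟨ε, hε, h⟩ := hcon
    refine ⟨ε, hε, h.mono fun g hg => ?_⟩
    simpa using hg
  set C := ‖coefficient lam p q A‖
  obtain ⟨N, hN⟩ := exists_nat_gt (‖S‖ * (C + 1) / ε)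
  rw [div_lt_iff₀ hε] at hN
  have hN0 : 0 < (N : ℝ) := by
    by_contra h0
    have : 0 ≤ ‖S‖ * (C + 1) := by positivity
    nlinarith
  obtain ⟨s, hcard, hs, hsum⟩ := exists_finset_sum_translates_le
    (fun x => (coefficient lam p q A).norm_coe_le_norm x) (inv_pos.2 hN0) hφ hfr N
  rw [mul_inv_cancel₀ hN0.ne'] at hsum
  -- the phases which align the values `ψ g`
  set ψ := coefficient lam p q (S A) with hψ
  set c : G → ℂ := fun g => (starRingEnd ℂ) (ψ g) / ‖ψ g‖ with hc
  have hc1 : ∀ g, ‖c g‖ ≤ 1 := by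
    intro g
    rw [hc]
    simp only [norm_div, RCLike.norm_conj, Complex.norm_real, norm_norm]
    exact div_self_le_one _
  have hcψ : ∀ g, c g * ψ g = ((‖ψ g‖ : ℝ) : ℂ) := by
    intro g
    simp only [hc]
    rw [div_mul_eq_mul_div, ← Complex.normSq_eq_conj_mul_self, Complex.normSq_eq_norm_sq, sq,
      ← Complex.ofReal_div, mul_self_div_self]
  have h1 := hS.norm_sum_coefficient_le p q A s c (B := C + 1) fun x => by
    refine (norm_sum_le _ _).trans ((Finset.sum_le_sum fun g _ => ?_).trans (hsum x))
    rw [norm_mul]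
    exact mul_le_of_le_one_left (norm_nonneg _) (hc1 g)
  rw [← hψ] at h1
  simp only [hcψ] at h1
  rw [← Complex.ofReal_sum, Complex.norm_real,
    Real.norm_of_nonneg (Finset.sum_nonneg fun _ _ => norm_nonneg _)] at h1
  have h2 : N * ε ≤ ∑ g ∈ s, ‖ψ g‖ := by
    rw [← hcard, ← nsmul_eq_mul]
    exact Finset.card_nsmul_le_sum _ _ _ hs
  linarith

/-- The coefficients of a `μ`-harmonic operator are `μ`-harmonic functions. -/
theorem coefficient_eq_integral {μ : Measure G} {B : L2 lam →L[ℂ] L2 lam}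
    (hB : B ∈ harmonicOperators lam μ) (p q : L2 lam) (h : G) :
    coefficient lam p q B h = ∫ g, coefficient lam p q B (h * g) ∂μ := by
  have := hB _ (isTraceClass_rankOne (rightRegular lam h⁻¹ p) (rightRegular lam h⁻¹ q))
  simp only [← coefficient_apply_eq_trace, coefficient_rightRegular] at this
  rw [← this, trace_rankOne_comp, coefficient_apply]

theorem apply_eq_zero_of_mem_vanishingOperators {μ : Measure G} [IsProbabilityMeasure μ]
    (hμ : ¬ IsCompact (supportSubgroup μ : Set G))
    {S : (L2 lam →L[ℂ] L2 lam) →L[ℂ] (L2 lam →L[ℂ] L2 lam)}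
    (hH : ∀ A, S A ∈ harmonicOperators lam μ) (hS : CommutesWithCommutant lam S)
    {A : L2 lam →L[ℂ] L2 lam} (hA : A ∈ vanishingOperators lam) : S A = 0 := by
  ext1 q
  refine ext_inner_left ℂ fun p => ?_
  have h := eq_zero_of_harmonic hμ (coefficient lam p q (S A)).continuous
    (hS.tendsto_coefficient hA p q) (coefficient_eq_integral (hH A) p q) 1
  rw [coefficient_apply_one] at h
  rw [h, _root_.zero_apply, inner_zero_right]

theorem one_mem_harmonicOperators (μ : Measure G) [IsProbabilityMeasure μ] :
    (1 : L2 lam →L[ℂ] L2 lam) ∈ harmonicOperators lam μ := by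
  intro T _
  have : ∀ g : G, conjAction lam g 1 = 1 := fun g => by
    ext1 f
    rw [conjAction_apply, one_apply_eq_self, rightRegular_apply_inv_apply, one_apply_eq_self]
  simp [this]

omit [IsTopologicalGroup G] [SecondCountableTopology G] in
theorem exists_ne_zero_L2 (lam : Measure G) [lam.IsHaarMeasure] : ∃ f : L2 lam, f ≠ 0 := by
  obtain ⟨K, hK, hK1⟩ := exists_compact_mem_nhds (1 : G)
  refine ⟨indicatorConstLp 2 hK.measurableSet hK.measure_lt_top.ne (1 : ℂ), norm_ne_zero_iff.1 ?_⟩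
  rw [norm_indicatorConstLp (by simp) (by simp), norm_one, one_mul]
  exact (Real.rpow_pos_of_pos (ENNReal.toReal_pos (Measure.measure_pos_of_mem_nhds lam hK1).ne'
    hK.measure_lt_top.ne) _).ne'

end Commutant

end ChoquetDeny

theorem proposition7p8 {G : Type*} [Group G] [TopologicalSpace G] [IsTopologicalGroup G]
    [LocallyCompactSpace G] [SecondCountableTopology G] [T2Space G]
    [MeasurableSpace G] [BorelSpace G]
    (lam : MeasureTheory.Measure G) [lam.IsHaarMeasure]
    (μ : MeasureTheory.Measure G) [MeasureTheory.IsProbabilityMeasure μ]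
    (hμ : ¬ IsCompact (ChoquetDeny.supportSubgroup μ : Set G)) :
    (∀ S : (ChoquetDeny.L2 lam →L[ℂ] ChoquetDeny.L2 lam) →L[ℂ]
          (ChoquetDeny.L2 lam →L[ℂ] ChoquetDeny.L2 lam),
        (∀ A, S A ∈ ChoquetDeny.harmonicOperators lam μ) →
        ChoquetDeny.CommutesWithCommutant lam S →
        ∀ A ∈ ChoquetDeny.vanishingOperators lam, S A = 0) ∧
    (∀ P : (ChoquetDeny.L2 lam →L[ℂ] ChoquetDeny.L2 lam) →L[ℂ]
          (ChoquetDeny.L2 lam →L[ℂ] ChoquetDeny.L2 lam),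
        (∀ A, P A ∈ ChoquetDeny.harmonicOperators lam μ) →
        (∀ A ∈ ChoquetDeny.harmonicOperators lam μ, P A = A) →
        ChoquetDeny.CommutesWithCommutant lam P →
        (∀ A ∈ ChoquetDeny.vanishingOperators lam, P A = 0) ∧
          ¬ ChoquetDeny.IsWeakStarContinuous P ∧
          ChoquetDeny.IsSingularOperator P) := by
  refine ⟨fun S hH hS A hA => ChoquetDeny.apply_eq_zero_of_mem_vanishingOperators hμ hH hS hA,
    fun P hH hP hc => ?_⟩
  have hzero : ∀ A ∈ ChoquetDeny.vanishingOperators lam, P A = 0 := fun A hA =>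
    ChoquetDeny.apply_eq_zero_of_mem_vanishingOperators hμ hH hc hA
  have hrank : ∀ x y : ChoquetDeny.L2 lam, P (InnerProductSpace.rankOne ℂ x y) = 0 := fun x y =>
    hzero _ (ChoquetDeny.rankOne_mem_vanishingOperators lam x y)
  refine ⟨hzero, fun hw => ?_, fun φ _ =>
    ChoquetDeny.isSingularFunctional_of_rankOne fun x y => ?_⟩
  · obtain ⟨f, hf⟩ := ChoquetDeny.exists_ne_zero_L2 lam
    have h := ChoquetDeny.apply_one_eq_zero_of_rankOne hw hrank f f
    rw [hP 1 (ChoquetDeny.one_mem_harmonicOperators μ), one_apply_eq_self] at h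
    exact hf (inner_self_eq_zero.1 h)
  · rw [ContinuousLinearMap.comp_apply, hrank, map_zero]
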